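/- Let $l,m\in\mathbb N$, $l,m\ge 1$, and let $E=\bigcup_{j=1}^{l}E_j$, $E_j=[a_{2j-1},a_{2j}]$, with real $a_1<a_2<\dots<a_{2l}$. Let $I_n=\bigcup_{k=1}^{m}[B_{k,n},C_{k,n}]$, $B_{k,n}<C_{k,n}$, be a sequence of unions of $m$ pairwise disjoint real intervals such that $\operatorname{dist}(E,I_n)\ge \delta$ for all $n$ with some $\delta>0$ and $\bigcap_{n}[B_{k,n},C_{k,n}]=\{c_k\}$ for $k=1,\dots,m$. For a finite union $K$ of disjoint nondegenerate compact real intervals and $p\in\overline{\mathbb C}\setminus K$ let $|\phi(\cdot,p,K)|=e^{g(\cdot,p,K)}$, where $g(\cdot,p,K)$ is the Green's function of $\overline{\mathbb C}\setminus K$ with pole at $p$; let $\operatorname{cap}(K)=\lim_{z\to\infty}|z/\phi(z,\infty,K)|$; and for a union $K'$ of components of $K$ let $\omega(\cdot,K',K)$ be the harmonic measure of $K'$, i.e. the harmonic function on $\overline{\mathbb C}\setminus K$ with boundary values $1$ on $K'$ and $0$ on $K\setminus K'$. Put $\omega_{k,n}=\omega(\infty,[B_{k,n},C_{k,n}],E\cup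 I_n)$ and suppose that $\omega_{k,n}\to 0$ as $n\to\infty$ for every $k$. Then, as $n\to\infty$, (a) $\displaystyle \operatorname{cap}(E\cup I_n)=\operatorname{cap}(E)\,\prod_{k=1}^{m}|\phi(\infty,c_k,E)|^{\omega_{k,n}}\,\Bigl(1+O\bigl(\max_{1\le k\le m}\omega_{k,n}^2\bigr)\Bigr);$ (b) for every $j=1,\dots,l$, $\displaystyle \omega(\infty,E_j,E\cup I_n)=\omega(\infty,E_j,E)-\sum_{k=1}^{m}\omega_{k,n}\,\omega(c_k,E_j,E)+O\bigl(\max_{1\le k\le m}\omega_{k,n}^2\bigr).$ -/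

import Mathlib

open Set Filter Topology Asymptotics

noncomputable section

namespace GreenInterval

/-- The coordinate `w ↦ 1 / w` of the Riemann sphere `OnePoint ℂ` around `∞`. -/
def chartInfty (w : ℂ) : OnePoint ℂ :=
  open Classical in if w = 0 then OnePoint.infty else ((w⁻¹ : ℂ) : OnePoint ℂ)

/-- `u` is harmonic at the point `p` of the Riemann sphere; at `∞` this means that
`w ↦ u (1 / w)` is harmonic at `0`. -/
def HarmonicAtSphere (u : OnePoint ℂ → ℝ) : OnePoint ℂ → Prop
  | none => InnerProductSpace.HarmonicAt (fun w : ℂ => u (chartInfty w)) 0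
  | some z => InnerProductSpace.HarmonicAt (fun w : ℂ => u (w : OnePoint ℂ)) z

/-- The complement of `E` in the Riemann sphere; it contains `∞`. -/
def sphereCompl (E : Set ℂ) : Set (OnePoint ℂ) :=
  ((fun z : ℂ => (z : OnePoint ℂ)) '' E)ᶜ

/-- `g` has a logarithmic pole at `p`: `g(z) + log |z - z₀|` has a finite limit at `p = z₀ ∈ ℂ`,
respectively `g(z) - log |z|` has a finite limit at `p = ∞`. -/
def HasLogPole (g : OnePoint ℂ → ℝ) : OnePoint ℂ → Prop
  | none => ∃ γ : ℝ, Tendsto (fun z : ℂ => g (z : OnePoint ℂ) - Real.log ‖z‖)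
      (Bornology.cobounded ℂ) (𝓝 γ)
  | some z₀ => ∃ γ : ℝ, Tendsto (fun z : ℂ => g (z : OnePoint ℂ) + Real.log ‖z - z₀‖)
      (𝓝[≠] z₀) (𝓝 γ)

/-- `g` is the Green's function, with pole at `p`, of the complement of the compact set `E` in the
Riemann sphere: it is harmonic off `E ∪ {p}`, has a logarithmic pole at `p` and boundary
values `0` on `E`. -/
structure IsGreenFunction (E : Set ℂ) (p : OnePoint ℂ) (g : OnePoint ℂ → ℝ) : Prop where
  harmonic : ∀ q ∈ sphereCompl E, q ≠ p → HarmonicAtSphere g q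
  pole : HasLogPole g p
  boundary : ∀ x ∈ E, Tendsto (fun z : ℂ => g (z : OnePoint ℂ)) (𝓝[Eᶜ] x) (𝓝 0)

/-- The Green's function `q ↦ g(q, p, E)` (its values on `E` and at `p` carry no meaning). -/
def greenFunction (E : Set ℂ) (p : OnePoint ℂ) : OnePoint ℂ → ℝ :=
  open Classical in if h : ∃ g, IsGreenFunction E p g then h.choose else 0

/-- The modulus `|φ(q, p, E)|` of the complex Green's function `φ`, that is, of the (multivalued)
analytic function for which `log |φ|` is the Green's function. Only the modulus is
single-valued. -/
def absPhi (q p : OnePoint ℂ) (E : Set ℂ) : ℝ :=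
  Real.exp (greenFunction E p q)

/-- The capacity `lim_{z → ∞} |z / φ(z, ∞, E)|`. -/
def capacity (E : Set ℂ) : ℝ :=
  limUnder (Bornology.cobounded ℂ)
    (fun z : ℂ => ‖z‖ / absPhi (z : OnePoint ℂ) OnePoint.infty E)

/-- `u` solves the Dirichlet problem on the complement of `E` in the Riemann sphere with boundary
values `1` on `K` and `0` on `E \ K`. Here `K ⊆ E` is relatively open and closed in `E`
(a union of components of `E`), so that the boundary data are continuous. -/
structure IsHarmonicMeasure (K E : Set ℂ) (u : OnePoint ℂ → ℝ) : Prop where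
  harmonic : ∀ q ∈ sphereCompl E, HarmonicAtSphere u q
  boundary_one : ∀ x ∈ K, Tendsto (fun z : ℂ => u (z : OnePoint ℂ)) (𝓝[Eᶜ] x) (𝓝 1)
  boundary_zero : ∀ x ∈ E \ K, Tendsto (fun z : ℂ => u (z : OnePoint ℂ)) (𝓝[Eᶜ] x) (𝓝 0)

/-- The harmonic measure `ω(q, K, E)` of `K` at the point `q` of the complement of `E`. -/
def harmonicMeasure (q : OnePoint ℂ) (K E : Set ℂ) : ℝ :=
  open Classical in if h : ∃ u, IsHarmonicMeasure K E u then h.choose q else 0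

/-- The real interval `[b, c]` as a subset of `ℂ`. -/
def interval (b c : ℝ) : Set ℂ := (fun x : ℝ => (x : ℂ)) '' Set.Icc b c

/-- The `j`-th interval `E_j`; with endpoints numbered from `0` it is `[a_{2j}, a_{2j+1}]`. -/
def band {l : ℕ} (a : Fin (2 * l) → ℝ) (j : Fin l) : Set ℂ :=
  interval (a ⟨2 * j.1, by omega⟩) (a ⟨2 * j.1 + 1, by omega⟩)

/-- `E = ⋃ j, E_j`. -/
def bands {l : ℕ} (a : Fin (2 * l) → ℝ) : Set ℂ := ⋃ j, band a j

/-- `I_n = ⋃ k, [B_{k,n}, C_{k,n}]`. -/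
def smallIntervals {m : ℕ} (B C : Fin m → ℕ → ℝ) (n : ℕ) : Set ℂ := ⋃ k, interval (B k n) (C k n)

end GreenInterval

end

/-!
The Dirichlet problem and the Green's functions are constructed by hand for finite unions of real
intervals, and the asymptotic formulas then follow from a single comparison argument.

*Uniqueness.* Everything rests on the minimum principle on the Riemann sphere
(`nonneg_of_boundary_of_isClosed`, `nonneg_of_boundary_of_pole`): by the local minimum principle the
set where a harmonic function attains a negative minimum is open and closed in the whole sphere.

*One interval.* The inverse Joukowski map `discMap` carries the complement of an interval to the unit
disc with `∞ ↦ 0`. Composed with Poisson integrals it solves the Dirichlet problem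
(`solvesDirichlet_interval`); the boundary behaviour is read off from quadratic data, whose Poisson
integrals are explicit. It also yields both Green's functions and Harnack's inequality.

*Several intervals.* An interval `J` is added to a set `K` by the alternating method. With Harnack's
inequality, passing boundary data from `J` to `K` and back is a strict contraction once a constant is
subtracted, so data can be solved up to a multiple of the indicator function of `J`
(`exists_dirichlet_union_sub_const`). Applied to the difference of the Green's functions of `J` and
`K`, which is harmonic at `∞`, this yields the harmonic measure of `J`: the multiple cannot vanish,
since otherwise an entire harmonic function would tend to `+∞` (`exists_harmonicMeasure_union`).

*Symmetry.* The capacity formula involves `|φ(∞, c, E)|`, whereas the comparison produces the Green's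
function with pole `∞` at `c`. They agree because the value at `∞` of the Green's function with pole
`c` is harmonic in `c`, has a logarithmic pole at `∞` and vanishes on `E`
(`exists_isGreenFunction_infty_eq`).

*Asymptotics.* Let `d` be the difference of the Green's functions with pole `∞`, respectively of the
harmonic measures of `E_j`, for `E` and for `E ∪ I_n`. It vanishes on `E`, and on the `k`-th small
interval it equals a fixed function `φ`, smooth near `c_k`, so it differs from `φ(c_k)` by at most a
multiple of the length. By the minimum principle `d(∞)` is `∑ ω_{k,n} φ(c_k)` up to a multiple
of the largest length times `∑ ω_{k,n}` (`abs_limit_sub_sum_le`). The lengths themselves are `O(max ω_{k,n})`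
(`exists_length_le`), because the harmonic measure of an interval within `[-R, R]` is at least
proportional to its length (`le_harmonicMeasure_interval`). So the error is quadratic
(`isBigO_limit_sub_sum`).
-/

namespace GreenInterval

open InnerProductSpace

/-! ### Harmonic functions on the Riemann sphere -/

lemma chartInfty_zero : chartInfty 0 = OnePoint.infty := by simp [chartInfty]

lemma chartInfty_of_ne {w : ℂ} (hw : w ≠ 0) : chartInfty w = ((w⁻¹ : ℂ) : OnePoint ℂ) := by
  simp [chartInfty, hw]

lemma nhdsNE_infty : 𝓝[≠] (OnePoint.infty : OnePoint ℂ) =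
    map (fun z : ℂ => (z : OnePoint ℂ)) (Bornology.cobounded ℂ) := by
  rw [OnePoint.nhdsNE_infty_eq, coclosedCompact_eq_cocompact, Metric.cobounded_eq_cocompact]

lemma map_chartInfty_nhdsNE :
    map chartInfty (𝓝[≠] (0 : ℂ)) = 𝓝[≠] (OnePoint.infty : OnePoint ℂ) := by
  rw [nhdsNE_infty, ← inv_nhdsNE_zero, ← Filter.map_inv, Filter.map_map]
  refine Filter.map_congr ?_
  filter_upwards [self_mem_nhdsWithin] with w hw
  simp [chartInfty_of_ne (show w ≠ 0 from hw)]

lemma map_chartInfty_nhds :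
    map chartInfty (𝓝 (0 : ℂ)) = 𝓝 (OnePoint.infty : OnePoint ℂ) := by
  rw [← nhdsNE_sup_pure, ← nhdsNE_sup_pure, Filter.map_sup, map_chartInfty_nhdsNE, Filter.map_pure,
    chartInfty_zero]

/-- Every point of the sphere has a coordinate in which harmonicity is harmonicity on `ℂ`; this
reduces all local statements on the sphere to the plane. -/
lemma exists_chart (q : OnePoint ℂ) : ∃ (φ : ℂ → OnePoint ℂ) (z : ℂ), φ z = q ∧
    map φ (𝓝 z) = 𝓝 q ∧ ∀ u, HarmonicAtSphere u q ↔ HarmonicAt (fun w => u (φ w)) z := by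
  induction q using OnePoint.rec with
  | infty => exact ⟨chartInfty, 0, chartInfty_zero, map_chartInfty_nhds, fun u => Iff.rfl⟩
  | coe z => exact ⟨fun w => w, z, rfl, (OnePoint.nhds_coe_eq z).symm, fun u => Iff.rfl⟩

lemma harmonicAtSphere_coe {u : OnePoint ℂ → ℝ} {z : ℂ} :
    HarmonicAtSphere u z ↔ HarmonicAt (fun w : ℂ => u w) z := Iff.rfl

lemma harmonicAtSphere_infty {u : OnePoint ℂ → ℝ} :
    HarmonicAtSphere u OnePoint.infty ↔ HarmonicAt (fun w : ℂ => u (chartInfty w)) 0 := Iff.rfl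

namespace HarmonicAtSphere

variable {u v : OnePoint ℂ → ℝ} {q : OnePoint ℂ}

lemma congr (hu : HarmonicAtSphere u q) (h : u =ᶠ[𝓝 q] v) : HarmonicAtSphere v q := by
  obtain ⟨φ, z, -, hφ, H⟩ := exists_chart q
  rw [← hφ] at h
  rw [H] at hu ⊢
  exact (harmonicAt_congr_nhds h).1 hu

lemma add (hu : HarmonicAtSphere u q) (hv : HarmonicAtSphere v q) :
    HarmonicAtSphere (fun p => u p + v p) q := by
  obtain ⟨φ, z, -, -, H⟩ := exists_chart q
  rw [H] at hu hv ⊢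
  exact HarmonicAt.add hu hv

lemma sub (hu : HarmonicAtSphere u q) (hv : HarmonicAtSphere v q) :
    HarmonicAtSphere (fun p => u p - v p) q := by
  obtain ⟨φ, z, -, -, H⟩ := exists_chart q
  rw [H] at hu hv ⊢
  exact HarmonicAt.sub hu hv

lemma const_mul (hu : HarmonicAtSphere u q) (c : ℝ) : HarmonicAtSphere (fun p => c * u p) q := by
  obtain ⟨φ, z, -, -, H⟩ := exists_chart q
  rw [H] at hu ⊢
  exact HarmonicAt.const_smul hu

lemma neg (hu : HarmonicAtSphere u q) : HarmonicAtSphere (fun p => - u p) q := by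
  simpa using hu.const_mul (-1)

lemma const (c : ℝ) (q : OnePoint ℂ) : HarmonicAtSphere (fun _ => c) q := by
  obtain ⟨φ, z, -, -, H⟩ := exists_chart q
  rw [H]
  exact harmonicAt_const c

lemma sum {ι : Type*} {s : Finset ι} {u : ι → OnePoint ℂ → ℝ}
    (h : ∀ i ∈ s, HarmonicAtSphere (u i) q) : HarmonicAtSphere (fun p => ∑ i ∈ s, u i p) q := by
  classical
  induction s using Finset.induction_on with
  | empty => simpa using const 0 q
  | insert a s ha ih =>
    simp only [Finset.sum_insert ha]
    exact (h a (by simp)).add (ih fun i hi => h i (by simp [hi]))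

lemma continuousAt (hu : HarmonicAtSphere u q) : ContinuousAt u q := by
  obtain ⟨φ, z, hz, hφ, H⟩ := exists_chart q
  rw [H] at hu
  have := hu.1.continuousAt
  rw [ContinuousAt, ← hφ, tendsto_map'_iff, ← hz]
  exact this

end HarmonicAtSphere

/-- The local minimum principle for harmonic functions in the plane. -/
lemma eventually_eq_of_isLocalMin_harmonicAt {u : ℂ → ℝ} {z : ℂ} (hu : HarmonicAt u z)
    (hmin : ∀ᶠ w in 𝓝 z, u z ≤ u w) : ∀ᶠ w in 𝓝 z, u w = u z := by
  obtain ⟨r, hr, hball⟩ := Metric.isOpen_iff.1 (isOpen_setOfPred_harmonicAt (f := u)) z hu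
  obtain ⟨F, hF, hFu⟩ := HarmonicOnNhd.exists_analyticOnNhd_ball_re_eq (fun _ hy => hball hy)
  have hev : ∀ᶠ w in 𝓝 z, w ∈ Metric.ball z r := Metric.ball_mem_nhds z hr
  have hnorm : ∀ w ∈ Metric.ball z r, ‖Complex.exp (- F w)‖ = Real.exp (- u w) := by
    intro w hw
    rw [Complex.norm_exp, Complex.neg_re]
    congr 2
    exact hFu hw
  have hzb : z ∈ Metric.ball z r := Metric.mem_ball_self hr
  have hd : ∀ᶠ w in 𝓝 z, DifferentiableAt ℂ (fun w => Complex.exp (- F w)) w := by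
    filter_upwards [hev] with w hw
    exact ((hF w hw).differentiableAt.neg).cexp
  have hmax : IsLocalMax (norm ∘ fun w => Complex.exp (- F w)) z := by
    filter_upwards [hev, hmin] with w hw hle
    simp only [Function.comp_apply]
    rw [hnorm w hw, hnorm z hzb]
    gcongr
  filter_upwards [Complex.norm_eventually_eq_of_isLocalMax hd hmax, hev] with w h1 h2
  rw [hnorm w h2, hnorm z hzb] at h1
  have := Real.exp_injective h1
  linarith

lemma HarmonicAtSphere.eventually_eq_of_isLocalMin {u : OnePoint ℂ → ℝ} {q : OnePoint ℂ}
    (hu : HarmonicAtSphere u q) (hmin : ∀ᶠ p in 𝓝 q, u q ≤ u p) : ∀ᶠ p in 𝓝 q, u p = u q := by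
  obtain ⟨φ, z, hz, hφ, H⟩ := exists_chart q
  rw [H] at hu
  rw [← hφ, eventually_map, ← hz] at hmin ⊢
  exact eventually_eq_of_isLocalMin_harmonicAt hu hmin

/-! ### The minimum principle -/

/-- **Minimum principle** on the complement of an arbitrary nonempty closed subset of the sphere.
No connectedness is needed: the set where a negative minimum is attained is open and closed in the
whole sphere. -/
theorem nonneg_of_boundary_of_isClosed {S : Set (OnePoint ℂ)} (hS : IsClosed S) (hne : S.Nonempty)
    {u : OnePoint ℂ → ℝ} (hu : ∀ q, q ∉ S → HarmonicAtSphere u q)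
    (hb : ∀ x ∈ S, ∀ ε > 0, ∀ᶠ q in 𝓝[Sᶜ] x, -ε < u q) : ∀ q, q ∉ S → 0 ≤ u q := by
  intro q₀ hq₀
  by_contra! hneg
  have hclosed : ∀ t < 0, IsClosed {q | q ∉ S ∧ u q ≤ t} := by
    intro t ht
    refine isClosed_of_closure_subset fun q hq => ?_
    rw [mem_closure_iff_frequently] at hq
    by_cases hqS : q ∈ S
    · have := hb q hqS (-t) (by linarith)
      rw [eventually_nhdsWithin_iff] at this
      obtain ⟨p, hp, hp'⟩ := (hq.and_eventually this).exists
      have := hp' hp.1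
      linarith [hp.2]
    · refine ⟨hqS, ?_⟩
      by_contra! hlt
      have h1 := (hu q hqS).continuousAt.eventually (lt_mem_nhds hlt)
      obtain ⟨p, hp, hp'⟩ := (hq.and_eventually h1).exists
      linarith [hp.2]
  obtain ⟨q₁, hq₁, hmin⟩ := (hclosed _ hneg).isCompact.exists_isMinOn ⟨q₀, hq₀, le_rfl⟩
    (f := u) (fun q hq => (hu q hq.1).continuousAt.continuousWithinAt)
  have hglob : ∀ q, q ∉ S → u q₁ ≤ u q := by
    intro q hq
    rcases le_total (u q) (u q₀) with h | h
    · exact hmin ⟨hq, h⟩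
    · exact hq₁.2.trans h
  have hclop : IsClopen {q | q ∉ S ∧ u q ≤ u q₁} := by
    refine ⟨hclosed _ (hq₁.2.trans_lt hneg), isOpen_iff_mem_nhds.2 fun q hq => ?_⟩
    have heq : u q = u q₁ := le_antisymm hq.2 (hglob q hq.1)
    have hSo : ∀ᶠ p in 𝓝 q, p ∉ S := hS.isOpen_compl.mem_nhds hq.1
    have h1 := (hu q hq.1).eventually_eq_of_isLocalMin
      (hSo.mono fun p hp => heq ▸ hglob p hp)
    filter_upwards [hSo, h1] with p hp hp'
    exact ⟨hp, by rw [hp', heq]⟩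
  have huniv := hclop.eq_univ ⟨q₁, hq₁.1, le_rfl⟩
  obtain ⟨x, hx⟩ := hne
  have : x ∈ {q | q ∉ S ∧ u q ≤ u q₁} := huniv ▸ mem_univ x
  exact this.1 hx

lemma isClosed_image_coe {K : Set ℂ} (hK : IsCompact K) :
    IsClosed ((fun z : ℂ => (z : OnePoint ℂ)) '' K) :=
  (hK.image OnePoint.continuous_coe).isClosed

lemma coe_mem_sphereCompl {K : Set ℂ} {z : ℂ} : (z : OnePoint ℂ) ∈ sphereCompl K ↔ z ∉ K := by
  simp [sphereCompl]

lemma infty_mem_sphereCompl (K : Set ℂ) : OnePoint.infty ∈ sphereCompl K := by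
  simp [sphereCompl]

lemma sphereCompl_anti {K K' : Set ℂ} (h : K ⊆ K') : sphereCompl K' ⊆ sphereCompl K :=
  compl_subset_compl.2 (image_mono h)

lemma isOpen_sphereCompl {K : Set ℂ} (hK : IsCompact K) : IsOpen (sphereCompl K) :=
  (isClosed_image_coe hK).isOpen_compl

lemma eventually_nhdsWithin_of_plane {K : Set ℂ} {S : Set (OnePoint ℂ)}
    (hS : (fun z : ℂ => (z : OnePoint ℂ)) '' K ⊆ S) {x : ℂ} {P : OnePoint ℂ → Prop}
    (h : ∀ᶠ z : ℂ in 𝓝[Kᶜ] x, P z) : ∀ᶠ q in 𝓝[Sᶜ] (x : OnePoint ℂ), P q := by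
  rw [eventually_nhdsWithin_iff] at h ⊢
  rw [OnePoint.nhds_coe_eq, eventually_map]
  filter_upwards [h] with z hz hzS
  exact hz fun hzK => hzS (hS ⟨z, hzK, rfl⟩)

/-- Minimum principle off a compact subset of the plane. -/
theorem nonneg_of_boundary {K : Set ℂ} (hK : IsCompact K) (hne : K.Nonempty)
    {u : OnePoint ℂ → ℝ} (hu : ∀ q ∈ sphereCompl K, HarmonicAtSphere u q)
    (hb : ∀ x ∈ K, ∀ ε > 0, ∀ᶠ z : ℂ in 𝓝[Kᶜ] x, -ε < u z) : ∀ q ∈ sphereCompl K, 0 ≤ u q := by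
  refine nonneg_of_boundary_of_isClosed (isClosed_image_coe hK) (hne.image _) hu ?_
  rintro _ ⟨x, hx, rfl⟩ ε hε
  exact eventually_nhdsWithin_of_plane subset_rfl (hb x hx ε hε)

/-- Minimum principle with one exceptional point `p`, near which `u` is only assumed bounded below.
The function `G`, which tends to `+∞` at `p`, dominates `u` there. -/
theorem nonneg_of_boundary_of_pole {K : Set ℂ} (hK : IsCompact K)
    {u G : OnePoint ℂ → ℝ} {p : OnePoint ℂ} (hp : p ∈ sphereCompl K)
    (hu : ∀ q ∈ sphereCompl K, q ≠ p → HarmonicAtSphere u q)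
    (hb : ∀ x ∈ K, ∀ ε > 0, ∀ᶠ z : ℂ in 𝓝[Kᶜ] x, -ε < u z)
    (hbdd : ∃ C, ∀ᶠ q in 𝓝[≠] p, C ≤ u q)
    (hG : ∀ q ∈ sphereCompl K, q ≠ p → HarmonicAtSphere G q)
    (hGb : ∀ x ∈ K, ∀ ε > 0, ∀ᶠ z : ℂ in 𝓝[Kᶜ] x, -ε < G z)
    (hGp : Tendsto G (𝓝[≠] p) atTop) :
    ∀ q ∈ sphereCompl K, q ≠ p → 0 ≤ u q := by
  set S : Set (OnePoint ℂ) := (fun z : ℂ => (z : OnePoint ℂ)) '' K ∪ {p} with hSdef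
  have hS : IsClosed S := (isClosed_image_coe hK).union isClosed_singleton
  have hmem : ∀ q, q ∉ S ↔ q ∈ sphereCompl K ∧ q ≠ p := by
    intro q
    simp only [hSdef, sphereCompl, mem_union, mem_singleton_iff, mem_compl_iff, not_or]
  have key : ∀ η > 0, ∀ q, q ∉ S → 0 ≤ u q + η * G q := by
    intro η hη
    refine nonneg_of_boundary_of_isClosed hS ⟨p, by simp [hSdef]⟩ ?_ ?_
    · intro q hq
      rw [hmem] at hq
      exact (hu q hq.1 hq.2).add ((hG q hq.1 hq.2).const_mul η)
    · rintro x (⟨z, hz, rfl⟩ | hx) ε hε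
      · refine eventually_nhdsWithin_of_plane (K := K) subset_union_left ?_
        filter_upwards [hb z hz (ε / 2) (by positivity), hGb z hz (ε / (2 * η)) (by positivity)]
          with w h1 h2
        have : -(ε / 2) < η * G w := by
          calc -(ε / 2) = η * -(ε / (2 * η)) := by field_simp
            _ < η * G w := by gcongr
        linarith
      · rw [mem_singleton_iff] at hx
        subst hx
        obtain ⟨C, hC⟩ := hbdd
        have hle : 𝓝[Sᶜ] x ≤ 𝓝[≠] x := nhdsWithin_mono _ fun q hq hqx => hq (Or.inr hqx)
        filter_upwards [hle hC, hle (hGp.eventually_gt_atTop ((-ε - C) / η))] with q h1 h2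
        rw [div_lt_iff₀ hη] at h2
        linarith
  intro q hq hqp
  have hqS := (hmem q).2 ⟨hq, hqp⟩
  have ht : Tendsto (fun η : ℝ => u q + η * G q) (𝓝[>] 0) (𝓝 (u q + 0 * G q)) := by
    refine Tendsto.mono_left ?_ nhdsWithin_le_nhds
    exact tendsto_const_nhds.add (tendsto_id.mul_const _)
  have := ge_of_tendsto ht (by filter_upwards [self_mem_nhdsWithin] with η hη using key η hη q hqS)
  simpa using this

/-! ### The Dirichlet problem -/

/-- `u` solves the Dirichlet problem on the complement of `K` in the sphere with boundary values
`f` on `K`. -/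
structure SolvesDirichlet (K : Set ℂ) (f : ℂ → ℝ) (u : OnePoint ℂ → ℝ) : Prop where
  harmonic : ∀ q ∈ sphereCompl K, HarmonicAtSphere u q
  boundary : ∀ x ∈ K, Tendsto (fun z : ℂ => u z) (𝓝[Kᶜ] x) (𝓝 (f x))

lemma eventually_neg_lt_of_tendsto {α : Type*} {l : Filter α} {f : α → ℝ} {a : ℝ}
    (h : Tendsto f l (𝓝 a)) (ha : 0 ≤ a) : ∀ ε > 0, ∀ᶠ x in l, -ε < f x :=
  fun ε hε => h.eventually (lt_mem_nhds (by linarith))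

namespace SolvesDirichlet

variable {K : Set ℂ} {f g : ℂ → ℝ} {u v : OnePoint ℂ → ℝ}

lemma add (hu : SolvesDirichlet K f u) (hv : SolvesDirichlet K g v) :
    SolvesDirichlet K (fun x => f x + g x) (fun q => u q + v q) :=
  ⟨fun q hq => (hu.harmonic q hq).add (hv.harmonic q hq),
    fun x hx => (hu.boundary x hx).add (hv.boundary x hx)⟩

lemma sub (hu : SolvesDirichlet K f u) (hv : SolvesDirichlet K g v) :
    SolvesDirichlet K (fun x => f x - g x) (fun q => u q - v q) :=
  ⟨fun q hq => (hu.harmonic q hq).sub (hv.harmonic q hq),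
    fun x hx => (hu.boundary x hx).sub (hv.boundary x hx)⟩

lemma const_mul (hu : SolvesDirichlet K f u) (c : ℝ) :
    SolvesDirichlet K (fun x => c * f x) (fun q => c * u q) :=
  ⟨fun q hq => (hu.harmonic q hq).const_mul c,
    fun x hx => (hu.boundary x hx).const_mul c⟩

lemma const (K : Set ℂ) (c : ℝ) : SolvesDirichlet K (fun _ => c) (fun _ => c) :=
  ⟨fun q _ => HarmonicAtSphere.const c q, fun _ _ => tendsto_const_nhds⟩

lemma congr (hu : SolvesDirichlet K f u) (h : EqOn f g K) : SolvesDirichlet K g u :=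
  ⟨hu.harmonic, fun x hx => h hx ▸ hu.boundary x hx⟩

lemma nonneg (hu : SolvesDirichlet K f u) (hK : IsCompact K) (hne : K.Nonempty)
    (hf : ∀ x ∈ K, 0 ≤ f x) : ∀ q ∈ sphereCompl K, 0 ≤ u q :=
  nonneg_of_boundary hK hne hu.harmonic fun x hx =>
    eventually_neg_lt_of_tendsto (hu.boundary x hx) (hf x hx)

lemma mono (hu : SolvesDirichlet K f u) (hv : SolvesDirichlet K g v) (hK : IsCompact K)
    (hne : K.Nonempty) (hfg : ∀ x ∈ K, f x ≤ g x) : ∀ q ∈ sphereCompl K, u q ≤ v q := by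
  intro q hq
  have := (hv.sub hu).nonneg hK hne (fun x hx => by linarith [hfg x hx]) q hq
  linarith

lemma abs_le (hu : SolvesDirichlet K f u) (hK : IsCompact K) (hne : K.Nonempty) {C : ℝ}
    (hf : ∀ x ∈ K, |f x| ≤ C) : ∀ q ∈ sphereCompl K, |u q| ≤ C := by
  intro q hq
  rw [_root_.abs_le]
  exact ⟨(const K (-C)).mono hu hK hne (fun x hx => (_root_.abs_le.1 (hf x hx)).1) q hq,
    hu.mono (const K C) hK hne (fun x hx => (_root_.abs_le.1 (hf x hx)).2) q hq⟩

lemma unique (hu : SolvesDirichlet K f u) (hv : SolvesDirichlet K g v) (hK : IsCompact K)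
    (hne : K.Nonempty) (hfg : EqOn f g K) : ∀ q ∈ sphereCompl K, u q = v q := fun q hq =>
  le_antisymm (hu.mono hv hK hne (fun _ hx => (hfg hx).le) q hq)
    (hv.mono hu hK hne (fun _ hx => (hfg hx).ge) q hq)

lemma continuousAt (hu : SolvesDirichlet K f u) {z : ℂ} (hz : z ∉ K) :
    ContinuousAt (fun z : ℂ => u z) z :=
  (hu.harmonic z (coe_mem_sphereCompl.2 hz)).1.continuousAt

end SolvesDirichlet

open Metric

/-! ### The Poisson integral on the unit disc -/

/-- The Poisson integral at `w` of the boundary function `g` on the unit circle. -/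
noncomputable def poissonIntegral (g : ℂ → ℝ) (w : ℂ) : ℝ :=
  Real.circleAverage ((Complex.re ∘ herglotzRieszKernel 0 w) • g) 0 1

section Poisson

variable {g g₁ g₂ : ℂ → ℝ} {w : ℂ}

lemma circleIntegrable_poisson (hg : ContinuousOn g (sphere 0 1)) (hw : w ∈ ball (0 : ℂ) 1) :
    CircleIntegrable ((Complex.re ∘ herglotzRieszKernel 0 w) • g) 0 1 := by
  refine ContinuousOn.circleIntegrable' ?_
  have h := continuousOn_herglotzRieszKernel_sphere hw
  simp only [abs_one] at h ⊢
  exact (Complex.continuous_re.comp_continuousOn h).smul hg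

lemma re_herglotz_lower {ζ : ℂ} (hζ : ζ ∈ sphere (0 : ℂ) 1) (hw : w ∈ ball (0 : ℂ) 1) :
    (1 - ‖w‖) / (1 + ‖w‖) ≤ (herglotzRieszKernel 0 w ζ).re := by
  simpa [herglotzRieszKernel_def] using le_re_herglotzRieszKernel hζ hw

lemma re_herglotz_nonneg {ζ : ℂ} (hζ : ζ ∈ sphere (0 : ℂ) 1) (hw : w ∈ ball (0 : ℂ) 1) :
    0 ≤ (herglotzRieszKernel 0 w ζ).re := by
  have hw' : ‖w‖ < 1 := by simpa using hw
  exact (div_nonneg (by linarith) (by positivity)).trans (re_herglotz_lower hζ hw)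

lemma poissonIntegral_mono (hg₁ : ContinuousOn g₁ (sphere 0 1)) (hg₂ : ContinuousOn g₂ (sphere 0 1))
    (hw : w ∈ ball (0 : ℂ) 1) (h : ∀ ζ ∈ sphere (0 : ℂ) 1, g₁ ζ ≤ g₂ ζ) :
    poissonIntegral g₁ w ≤ poissonIntegral g₂ w := by
  refine Real.circleAverage_mono (circleIntegrable_poisson hg₁ hw)
    (circleIntegrable_poisson hg₂ hw) fun ζ hζ => ?_
  rw [abs_one] at hζ
  exact mul_le_mul_of_nonneg_left (h ζ hζ) (re_herglotz_nonneg hζ hw)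

/-- Harnack's inequality on the unit disc. -/
lemma harnack_poissonIntegral (hg : ContinuousOn g (sphere 0 1)) (hw : w ∈ ball (0 : ℂ) 1)
    (h : ∀ ζ ∈ sphere (0 : ℂ) 1, 0 ≤ g ζ) :
    (1 - ‖w‖) / (1 + ‖w‖) * Real.circleAverage g 0 1 ≤ poissonIntegral g w := by
  rw [← smul_eq_mul, ← Real.circleAverage_smul]
  refine Real.circleAverage_mono ?_ (circleIntegrable_poisson hg hw) fun ζ hζ => ?_
  · refine ContinuousOn.circleIntegrable' ?_
    rw [abs_one]
    exact hg.const_smul _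
  · rw [abs_one] at hζ
    exact mul_le_mul_of_nonneg_right (re_herglotz_lower hζ hw) (h ζ hζ)

lemma poissonIntegral_zero :
    poissonIntegral g 0 = Real.circleAverage g 0 1 := by
  refine Real.circleAverage_congr_sphere fun ζ hζ => ?_
  have : ζ ≠ 0 := by rintro rfl; simp at hζ
  simp [herglotzRieszKernel_def, this]

lemma exists_analytic_re_eq_poissonIntegral (hg : ContinuousOn g (sphere 0 1)) :
    ∃ F : ℂ → ℂ, AnalyticOnNhd ℂ F (ball 0 1) ∧
      ∀ w ∈ ball (0 : ℂ) 1, poissonIntegral g w = (F w).re := by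
  have hgi : CircleIntegrable g 0 1 := ContinuousOn.circleIntegrable' (by rwa [abs_one])
  have hgi' : CircleIntegrable (fun ζ => (g ζ : ℂ)) 0 1 := by
    refine ContinuousOn.circleIntegrable' ?_
    rw [abs_one]
    exact Complex.continuous_ofReal.comp_continuousOn hg
  exact ⟨_, analyticOnNhd_circleAverage_herglotzRieszKernel_smul hgi',
    fun w hw => (re_circleAverage_herglotzRieszKernel_smul hgi hw).symm⟩

lemma poissonIntegral_re {F : ℂ → ℂ} (hF : Differentiable ℂ F) (hw : w ∈ ball (0 : ℂ) 1) :
    poissonIntegral (fun ζ => (F ζ).re) w = (F w).re := by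
  refine HarmonicOnNhd.circleAverage_re_herglotzRieszKernel_smul (fun z _ => ?_) hw
  exact (hF.analyticAt z).harmonicAt_re

/-- A quantitative form of the boundary continuity of Poisson integrals: a bound of the boundary
function by the real part of an entire function persists inside the disc. -/
lemma abs_poissonIntegral_sub_le (hg : ContinuousOn g (sphere 0 1)) {F : ℂ → ℂ}
    (hF : Differentiable ℂ F) {a : ℝ} (hw : w ∈ ball (0 : ℂ) 1)
    (h : ∀ ζ ∈ sphere (0 : ℂ) 1, |g ζ - a| ≤ (F ζ).re) :
    |poissonIntegral g w - a| ≤ (F w).re := by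
  have hFa : Differentiable ℂ fun ζ => (a : ℂ) + F ζ := hF.const_add _
  have hFs : Differentiable ℂ fun ζ => (a : ℂ) - F ζ := hF.const_sub _
  have hc1 := (Complex.continuous_re.comp hFa.continuous).continuousOn (s := sphere (0 : ℂ) 1)
  have hc2 := (Complex.continuous_re.comp hFs.continuous).continuousOn (s := sphere (0 : ℂ) 1)
  have h1 := poissonIntegral_mono hg hc1 hw fun ζ hζ => by
    have := (abs_le.1 (h ζ hζ)).2
    simp only [Function.comp_apply, Complex.add_re, Complex.ofReal_re]
    linarith
  have h2 := poissonIntegral_mono hc2 hg hw fun ζ hζ => by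
    have := (abs_le.1 (h ζ hζ)).1
    simp only [Function.comp_apply, Complex.sub_re, Complex.ofReal_re]
    linarith
  have e1 := poissonIntegral_re hFa hw
  have e2 := poissonIntegral_re hFs hw
  simp only [Complex.add_re, Complex.sub_re, Complex.ofReal_re, Function.comp_def] at h1 h2 e1 e2
  rw [abs_le]
  constructor <;> linarith

end Poisson

/-! ### The conformal map of the complement of an interval onto the disc -/

/-- `F : OnePoint ℂ → ℂ` is analytic at a point of the Riemann sphere. -/
def AnalyticAtSphere (F : OnePoint ℂ → ℂ) : OnePoint ℂ → Prop
  | none => AnalyticAt ℂ (fun w : ℂ => F (chartInfty w)) 0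
  | some z => AnalyticAt ℂ (fun w : ℂ => F w) z

lemma AnalyticAtSphere.exists_chart {F : OnePoint ℂ → ℂ} {q : OnePoint ℂ}
    (hF : AnalyticAtSphere F q) : ∃ (φ : ℂ → OnePoint ℂ) (z : ℂ), φ z = q ∧
      AnalyticAt ℂ (fun w => F (φ w)) z ∧
      ∀ u, HarmonicAtSphere u q ↔ HarmonicAt (fun w => u (φ w)) z := by
  induction q using OnePoint.rec with
  | infty => exact ⟨chartInfty, 0, chartInfty_zero, hF, fun u => Iff.rfl⟩
  | coe z => exact ⟨fun w => w, z, rfl, hF, fun u => Iff.rfl⟩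

lemma AnalyticAtSphere.harmonic_re_comp {F : OnePoint ℂ → ℂ} {q : OnePoint ℂ}
    (hF : AnalyticAtSphere F q) {A : ℂ → ℂ} (hA : AnalyticAt ℂ A (F q)) :
    HarmonicAtSphere (fun p => (A (F p)).re) q := by
  obtain ⟨φ, z, rfl, h, H⟩ := hF.exists_chart
  exact (H _).2 (AnalyticAt.fun_comp (f := fun w => F (φ w)) hA h).harmonicAt_re

lemma AnalyticAtSphere.harmonic_log_norm_comp {F : OnePoint ℂ → ℂ} {q : OnePoint ℂ}
    (hF : AnalyticAtSphere F q) {A : ℂ → ℂ} (hA : AnalyticAt ℂ A (F q)) (h0 : A (F q) ≠ 0) :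
    HarmonicAtSphere (fun p => Real.log ‖A (F p)‖) q := by
  obtain ⟨φ, z, rfl, h, H⟩ := hF.exists_chart
  exact (H _).2 ((AnalyticAt.fun_comp (f := fun w => F (φ w)) hA h).harmonicAt_log_norm h0)

lemma mem_interval {b c : ℝ} {z : ℂ} : z ∈ interval b c ↔ z.im = 0 ∧ b ≤ z.re ∧ z.re ≤ c := by
  constructor
  · rintro ⟨x, hx, rfl⟩
    exact ⟨by simp, by simpa using hx.1, by simpa using hx.2⟩
  · rintro ⟨h0, h1, h2⟩
    exact ⟨z.re, ⟨h1, h2⟩, Complex.ext (by simp) (by simp [h0])⟩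

lemma isCompact_interval (b c : ℝ) : IsCompact (interval b c) :=
  isCompact_Icc.image Complex.continuous_ofReal

lemma ofReal_mem_interval {b c x : ℝ} : (x : ℂ) ∈ interval b c ↔ x ∈ Icc b c := by
  simp [mem_interval]

/-- The Möbius map sending `b ↦ ∞`, `c ↦ 0`, `∞ ↦ 1`; it maps the complement of `[b, c]` to the slit
plane. -/
noncomputable def moebiusSlit (b c : ℝ) : OnePoint ℂ → ℂ
  | none => 1
  | some z => (z - c) / (z - b)

/-- The conformal map of the complement of `[b, c]` in the sphere onto the unit disc, with `∞ ↦ 0`: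
the inverse Joukowski map, written as a Cayley transform of the square root of `moebiusSlit`. -/
noncomputable def discMap (b c : ℝ) (q : OnePoint ℂ) : ℂ :=
  (1 - Complex.exp (Complex.log (moebiusSlit b c q) / 2)) /
    (1 + Complex.exp (Complex.log (moebiusSlit b c q) / 2))

section DiscMap

variable {b c : ℝ}

lemma moebiusSlit_mem_slitPlane (hbc : b < c) {q : OnePoint ℂ} (hq : q ∈ sphereCompl (interval b c)) :
    moebiusSlit b c q ∈ Complex.slitPlane := by
  induction q using OnePoint.rec with
  | infty => exact Complex.one_mem_slitPlane
  | coe z =>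
    rw [coe_mem_sphereCompl] at hq
    by_contra hcon
    rw [Complex.mem_slitPlane_iff_not_le_zero, not_not] at hcon
    have hz : z - b ≠ 0 := by
      intro h0
      exact hq (by rw [sub_eq_zero.1 h0, ofReal_mem_interval]; exact ⟨le_rfl, hbc.le⟩)
    obtain ⟨hre, him⟩ := Complex.le_def.1 hcon
    set t : ℝ := -(moebiusSlit b c z).re with ht
    have ht0 : 0 ≤ t := by simpa [ht] using hre
    have hQ : moebiusSlit b c z = ((-t : ℝ) : ℂ) := Complex.ext (by simp [ht]) (by simpa using him)
    have hQ' : (z - c) / (z - b) = ((-t : ℝ) : ℂ) := hQ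
    rw [div_eq_iff hz] at hQ'
    have ht1 : (0 : ℝ) < 1 + t := by linarith
    have hzeq : z = (((c + t * b) / (1 + t) : ℝ) : ℂ) := by
      push_cast
      rw [eq_div_iff (by exact_mod_cast ht1.ne')]
      push_cast at hQ'
      linear_combination hQ'
    apply hq
    rw [hzeq, ofReal_mem_interval]
    constructor
    · rw [le_div_iff₀ ht1]; nlinarith
    · rw [div_le_iff₀ ht1]; nlinarith

lemma analyticAtSphere_moebiusSlit (hbc : b < c) {q : OnePoint ℂ}
    (hq : q ∈ sphereCompl (interval b c)) : AnalyticAtSphere (moebiusSlit b c) q := by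
  induction q using OnePoint.rec with
  | infty =>
    have h : AnalyticAt ℂ (fun w : ℂ => (1 - c * w) / (1 - b * w)) 0 :=
      AnalyticAt.div (by fun_prop) (by fun_prop) (by simp)
    refine h.congr ?_
    filter_upwards with w
    by_cases hw : w = 0
    · subst hw
      simp [chartInfty_zero, moebiusSlit, OnePoint.infty]
    · rw [chartInfty_of_ne hw]
      change _ = (w⁻¹ - c) / (w⁻¹ - b)
      rw [← mul_div_mul_left (w⁻¹ - (c : ℂ)) (w⁻¹ - b) hw]
      congr 1 <;> field_simp
  | coe z =>
    rw [coe_mem_sphereCompl] at hq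
    have hz : z - b ≠ 0 := by
      intro h0
      exact hq (by rw [sub_eq_zero.1 h0, ofReal_mem_interval]; exact ⟨le_rfl, hbc.le⟩)
    exact AnalyticAt.div (by fun_prop) (by fun_prop) hz

lemma re_exp_half_log_pos {Q : ℂ} (hQ : Q ∈ Complex.slitPlane) :
    0 < (Complex.exp (Complex.log Q / 2)).re := by
  rw [Complex.exp_re]
  have him : (Complex.log Q / 2).im = Complex.arg Q / 2 := by
    rw [← Complex.log_im]
    simp
  rw [him]
  refine mul_pos (Real.exp_pos _) (Real.cos_pos_of_mem_Ioo ⟨?_, ?_⟩)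
  · linarith [Complex.neg_pi_lt_arg Q]
  · have := Complex.arg_lt_pi_iff.2 ((Complex.mem_slitPlane_iff.1 hQ).imp le_of_lt id)
    linarith

lemma exp_half_log_sq {Q : ℂ} (hQ : Q ≠ 0) : Complex.exp (Complex.log Q / 2) ^ 2 = Q := by
  rw [← Complex.exp_nat_mul]
  push_cast
  rw [mul_div_cancel₀ _ two_ne_zero, Complex.exp_log hQ]

lemma one_add_ne_zero_of_re_pos {s : ℂ} (hs : 0 < s.re) : 1 + s ≠ 0 := by
  intro h
  have := congrArg Complex.re h
  simp at this
  linarith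

lemma analyticAtSphere_discMap (hbc : b < c) {q : OnePoint ℂ}
    (hq : q ∈ sphereCompl (interval b c)) : AnalyticAtSphere (discMap b c) q := by
  have hQ := moebiusSlit_mem_slitPlane hbc hq
  have hA : AnalyticAt ℂ (fun Q : ℂ => (1 - Complex.exp (Complex.log Q / 2)) /
      (1 + Complex.exp (Complex.log Q / 2))) (moebiusSlit b c q) := by
    have hlog : AnalyticAt ℂ (fun Q : ℂ => Complex.exp (Complex.log Q / 2)) (moebiusSlit b c q) :=
      ((analyticAt_clog hQ).div analyticAt_const two_ne_zero).cexp
    exact (analyticAt_const.sub hlog).div (analyticAt_const.add hlog)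
      (one_add_ne_zero_of_re_pos (re_exp_half_log_pos hQ))
  have hM := analyticAtSphere_moebiusSlit hbc hq
  induction q using OnePoint.rec with
  | infty =>
    refine AnalyticAt.fun_comp (f := fun w => moebiusSlit b c (chartInfty w)) (x := (0 : ℂ))
      (g := fun Q : ℂ => (1 - Complex.exp (Complex.log Q / 2)) /
        (1 + Complex.exp (Complex.log Q / 2))) ?_ hM
    rw [chartInfty_zero]; exact hA
  | coe z => exact AnalyticAt.fun_comp (f := fun w : ℂ => moebiusSlit b c w) hA hM

lemma norm_discMap_lt_one (hbc : b < c) {q : OnePoint ℂ} (hq : q ∈ sphereCompl (interval b c)) :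
    ‖discMap b c q‖ < 1 := by
  have hre := re_exp_half_log_pos (moebiusSlit_mem_slitPlane hbc hq)
  rw [discMap, norm_div]
  set s := Complex.exp (Complex.log (moebiusSlit b c q) / 2)
  rw [div_lt_one (norm_pos_iff.2 (one_add_ne_zero_of_re_pos hre))]
  rw [← sq_lt_sq₀ (norm_nonneg _) (norm_nonneg _), ← Complex.normSq_eq_norm_sq,
    ← Complex.normSq_eq_norm_sq, Complex.normSq_apply, Complex.normSq_apply]
  simp
  nlinarith

lemma discMap_mem_ball (hbc : b < c) {q : OnePoint ℂ} (hq : q ∈ sphereCompl (interval b c)) :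
    discMap b c q ∈ ball (0 : ℂ) 1 := by
  simpa using norm_discMap_lt_one hbc hq

lemma discMap_infty : discMap b c OnePoint.infty = 0 := by
  simp [discMap, moebiusSlit]

/-- The Joukowski relation `z = (b + c) / 2 + (c - b) / 4 * (w + 1 / w)`, cleared of denominators. -/
lemma joukowski_discMap (hbc : b < c) {z : ℂ} (hz : z ∉ interval b c) :
    4 * (z - (b + c) / 2) * discMap b c z = (c - b) * (discMap b c z ^ 2 + 1) := by
  have hsl := moebiusSlit_mem_slitPlane hbc (coe_mem_sphereCompl.2 hz)
  have hre := re_exp_half_log_pos hsl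
  have hsq := exp_half_log_sq (Complex.slitPlane_ne_zero hsl)
  have hzb : z - b ≠ 0 := by
    intro h0
    exact hz (by rw [sub_eq_zero.1 h0, ofReal_mem_interval]; exact ⟨le_rfl, hbc.le⟩)
  have hQ : moebiusSlit b c z = (z - c) / (z - b) := rfl
  rw [discMap]
  set s := Complex.exp (Complex.log (moebiusSlit b c z) / 2)
  have h1 := one_add_ne_zero_of_re_pos hre
  rw [hQ, eq_div_iff hzb] at hsq
  field_simp
  linear_combination (-8 : ℂ) * hsq

lemma discMap_ne_zero (hbc : b < c) {z : ℂ} (hz : z ∉ interval b c) : discMap b c z ≠ 0 := by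
  intro h
  have := joukowski_discMap hbc hz
  rw [h] at this
  simp only [mul_zero, ne_eq, OfNat.ofNat_ne_zero, not_false_eq_true, zero_pow, zero_add,
    mul_one] at this
  have h2 : (c : ℂ) = b := (sub_eq_zero.1 this.symm)
  exact hbc.ne' (by exact_mod_cast h2)

/-- At `∞` the map `discMap` has a simple zero. -/
lemma exists_discMap_chartInfty (hbc : b < c) : ∃ k : ℂ → ℂ, AnalyticAt ℂ k 0 ∧ k 0 ≠ 0 ∧
    ∀ᶠ w in 𝓝 0, discMap b c (chartInfty w) = w * k w := by
  set s : ℂ → ℂ := fun w => Complex.exp (Complex.log (moebiusSlit b c (chartInfty w)) / 2) with hs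
  have hinf := infty_mem_sphereCompl (interval b c)
  have hMa : AnalyticAt ℂ (fun w => moebiusSlit b c (chartInfty w)) 0 :=
    analyticAtSphere_moebiusSlit hbc hinf
  have hsl : moebiusSlit b c (chartInfty 0) ∈ Complex.slitPlane := by
    rw [chartInfty_zero]; exact moebiusSlit_mem_slitPlane hbc hinf
  have hsa : AnalyticAt ℂ s 0 := (((hMa.clog hsl).div analyticAt_const two_ne_zero)).cexp
  have hs0 : s 0 = 1 := by simp [hs, chartInfty_zero, moebiusSlit, OnePoint.infty]
  have hbc' : (c : ℂ) - b ≠ 0 := by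
    rw [sub_ne_zero]; exact_mod_cast hbc.ne'
  -- `1 - s ^ 2 = w * (c - b) / (1 - b * w)`, so `(1 - s) / (1 + s)` is `w` times the function below
  refine ⟨fun w => (c - b) / ((1 - b * w) * (1 + s w) ^ 2), ?_, ?_, ?_⟩
  · refine analyticAt_const.div ((by fun_prop : AnalyticAt ℂ (fun w : ℂ => 1 - b * w) 0).mul
      ((analyticAt_const.add hsa).pow 2)) ?_
    simp [hs0]
  · simp only [hs0, mul_zero, sub_zero, one_mul, ne_eq, div_eq_zero_iff, hbc', false_or]
    norm_num
  · have e1 : ∀ᶠ w in 𝓝 (0 : ℂ), 1 - (b : ℂ) * w ≠ 0 := by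
      have : ContinuousAt (fun w : ℂ => 1 - (b : ℂ) * w) 0 := by fun_prop
      exact this.eventually_ne (by simp)
    have e2 : ∀ᶠ w in 𝓝 (0 : ℂ), moebiusSlit b c (chartInfty w) ∈ Complex.slitPlane :=
      hMa.continuousAt.eventually (Complex.isOpen_slitPlane.mem_nhds hsl)
    filter_upwards [e1, e2] with w h1 h2
    have h3 := one_add_ne_zero_of_re_pos (re_exp_half_log_pos h2)
    have hsq := exp_half_log_sq (Complex.slitPlane_ne_zero h2)
    change (1 - s w) / (1 + s w) = w * ((c - b) / ((1 - b * w) * (1 + s w) ^ 2))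
    change s w ^ 2 = _ at hsq
    change 1 + s w ≠ 0 at h3
    have hM : moebiusSlit b c (chartInfty w) = (1 - c * w) / (1 - b * w) := by
      by_cases hw : w = 0
      · subst hw
        simp [chartInfty_zero, moebiusSlit, OnePoint.infty]
      · rw [chartInfty_of_ne hw]
        change (w⁻¹ - c) / (w⁻¹ - b) = _
        rw [← mul_div_mul_left (w⁻¹ - (c : ℂ)) (w⁻¹ - b) hw]
        congr 1 <;> field_simp
    rw [hM, eq_div_iff h1] at hsq
    rw [mul_div_assoc', div_eq_div_iff h3 (mul_ne_zero h1 (pow_ne_zero 2 h3))]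
    linear_combination -(1 + s w) * hsq

end DiscMap

/-! ### Potential theory of a single interval -/

/-- The point of `[b, c]` above which the boundary point `ζ` of the disc lies. -/
noncomputable def arcPoint (b c : ℝ) (ζ : ℂ) : ℂ := (((b + c) / 2 + (c - b) / 2 * ζ.re : ℝ) : ℂ)

section Interval

variable {b c : ℝ}

lemma arcPoint_mem (hbc : b < c) {ζ : ℂ} (hζ : ζ ∈ sphere (0 : ℂ) 1) :
    arcPoint b c ζ ∈ interval b c := by
  have h1 : |ζ.re| ≤ 1 := by
    simpa [mem_sphere_zero_iff_norm.1 hζ] using Complex.abs_re_le_norm ζ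
  rw [abs_le] at h1
  rw [arcPoint, ofReal_mem_interval]
  constructor <;> nlinarith

lemma continuous_arcPoint : Continuous (arcPoint b c) := by
  unfold arcPoint
  fun_prop

lemma continuousOn_comp_arcPoint (hbc : b < c) {f : ℂ → ℝ} (hf : ContinuousOn f (interval b c)) :
    ContinuousOn (fun ζ => f (arcPoint b c ζ)) (sphere 0 1) :=
  hf.comp continuous_arcPoint.continuousOn fun _ hζ => arcPoint_mem hbc hζ

lemma norm_discMap_relation (hbc : b < c) {z : ℂ} (hz : z ∉ interval b c) :
    2 * ‖discMap b c z‖ * (‖z - c‖ + ‖z - b‖) = (c - b) * (‖discMap b c z‖ ^ 2 + 1) := by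
  have hJ := joukowski_discMap hbc hz
  set w := discMap b c z
  have e1 : 4 * (z - c) * w = (c - b) * (w - 1) ^ 2 := by linear_combination hJ
  have e2 : 4 * (z - b) * w = (c - b) * (w + 1) ^ 2 := by linear_combination hJ
  have hcb : ‖(c : ℂ) - b‖ = c - b := by
    rw [← Complex.ofReal_sub, Complex.norm_real, Real.norm_of_nonneg (by linarith)]
  have n1 := congrArg norm e1
  have n2 := congrArg norm e2
  simp only [norm_mul, norm_pow, hcb, RCLike.norm_ofNat] at n1 n2
  have n3 : ‖w - 1‖ ^ 2 + ‖w + 1‖ ^ 2 = 2 * ‖w‖ ^ 2 + 2 := by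
    simp only [← Complex.normSq_eq_norm_sq, Complex.normSq_apply, Complex.sub_re, Complex.sub_im,
      Complex.add_re, Complex.add_im, Complex.one_re, Complex.one_im]
    ring
  linear_combination (n1 + n2) / 2 + (c - b) / 2 * n3

lemma re_discMap_relation (hbc : b < c) {z : ℂ} (hz : z ∉ interval b c) :
    (discMap b c z).re = 4 * (z.re - (b + c) / 2) * ‖discMap b c z‖ ^ 2 /
      ((c - b) * (‖discMap b c z‖ ^ 2 + 1)) := by
  have hJ := joukowski_discMap hbc hz
  set w := discMap b c z
  have h1 := congrArg (fun t => (t * (starRingEnd ℂ) w).re) hJ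
  have h2 : ‖w‖ ^ 2 = w.re ^ 2 + w.im ^ 2 := by
    rw [← Complex.normSq_eq_norm_sq, Complex.normSq_apply]; ring
  have : (c - b) * (‖w‖ ^ 2 + 1) ≠ 0 := by
    have : 0 < c - b := by linarith
    positivity
  rw [eq_div_iff this, h2]
  simp [pow_two] at h1
  linear_combination -h1

lemma tendsto_norm_discMap (hbc : b < c) {s : ℝ} (hs : s ∈ Icc b c) :
    Tendsto (fun z : ℂ => ‖discMap b c z‖) (𝓝[(interval b c)ᶜ] (s : ℂ)) (𝓝 1) := by
  have hcb : 0 < c - b := by linarith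
  have hlim : Tendsto (fun z : ℂ => Real.sqrt (2 * (‖z - c‖ + ‖z - b‖ - (c - b)) / (c - b)))
      (𝓝[(interval b c)ᶜ] (s : ℂ)) (𝓝 0) := by
    have hc : ContinuousAt
        (fun z : ℂ => Real.sqrt (2 * (‖z - c‖ + ‖z - b‖ - (c - b)) / (c - b))) s := by fun_prop
    have h0 : Real.sqrt (2 * (‖(s : ℂ) - c‖ + ‖(s : ℂ) - b‖ - (c - b)) / (c - b)) = 0 := by
      rw [← Complex.ofReal_sub, ← Complex.ofReal_sub, Complex.norm_real, Complex.norm_real,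
        Real.norm_of_nonpos (by linarith [hs.2]), Real.norm_of_nonneg (by linarith [hs.1])]
      simp
    have := hc.tendsto
    rw [h0] at this
    exact this.mono_left nhdsWithin_le_nhds
  rw [tendsto_iff_norm_sub_tendsto_zero]
  refine squeeze_zero' (Eventually.of_forall fun _ => norm_nonneg _) ?_ hlim
  filter_upwards [self_mem_nhdsWithin] with z hz
  have h1 := norm_discMap_lt_one hbc (coe_mem_sphereCompl.2 hz)
  have h2 := norm_discMap_relation hbc hz
  have h3 : 0 ≤ ‖discMap b c z‖ := norm_nonneg _
  set r := ‖discMap b c z‖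
  have key : (c - b) * (1 - r) ^ 2 = 2 * r * (‖z - c‖ + ‖z - b‖ - (c - b)) := by
    linear_combination -h2
  have hnn : 0 ≤ r * (‖z - c‖ + ‖z - b‖ - (c - b)) := by
    have : 0 ≤ (c - b) * (1 - r) ^ 2 := by positivity
    linarith
  rcases h3.eq_or_lt with h4 | h4
  · rw [← h4] at h2
    simp at h2
    linarith
  have hnn' : 0 ≤ ‖z - c‖ + ‖z - b‖ - (c - b) := by
    by_contra! hcon
    nlinarith
  rw [Real.norm_eq_abs]
  apply Real.abs_le_sqrt
  rw [le_div_iff₀ hcb]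
  nlinarith

lemma tendsto_re_discMap (hbc : b < c) {s : ℝ} (hs : s ∈ Icc b c) :
    Tendsto (fun z : ℂ => (discMap b c z).re) (𝓝[(interval b c)ᶜ] (s : ℂ))
      (𝓝 (2 * (s - (b + c) / 2) / (c - b))) := by
  have hcb : 0 < c - b := by linarith
  have h1 := tendsto_norm_discMap hbc hs
  have h2 : Tendsto (fun z : ℂ => z.re) (𝓝[(interval b c)ᶜ] (s : ℂ)) (𝓝 s) := by
    have := Complex.continuous_re.tendsto (s : ℂ)
    exact this.mono_left nhdsWithin_le_nhds
  have h3 : Tendsto (fun z : ℂ => 4 * (z.re - (b + c) / 2) * ‖discMap b c z‖ ^ 2 /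
      ((c - b) * (‖discMap b c z‖ ^ 2 + 1))) (𝓝[(interval b c)ᶜ] (s : ℂ))
      (𝓝 (4 * (s - (b + c) / 2) * 1 ^ 2 / ((c - b) * (1 ^ 2 + 1)))) := by
    refine (((h2.sub_const _).const_mul 4).mul (h1.pow 2)).div
      (((h1.pow 2).add_const 1).const_mul _) (by positivity)
  have e : 4 * (s - (b + c) / 2) * 1 ^ 2 / ((c - b) * (1 ^ 2 + 1)) =
      2 * (s - (b + c) / 2) / (c - b) := by
    field_simp; ring
  rw [e] at h3
  refine h3.congr' ?_
  filter_upwards [self_mem_nhdsWithin] with z hz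
  exact (re_discMap_relation hbc hz).symm

/-- A continuous function on a compact set differs from `f s` at `t` by at most
`ε + C * ‖t - s‖ ^ 2`. -/
lemma exists_quadratic_bound {K : Set ℂ} (hK : IsCompact K) {f : ℂ → ℝ} (hf : ContinuousOn f K)
    {s : ℂ} (hs : s ∈ K) {ε : ℝ} (hε : 0 < ε) :
    ∃ C, 0 ≤ C ∧ ∀ t ∈ K, |f t - f s| ≤ ε + C * ‖t - s‖ ^ 2 := by
  obtain ⟨δ, hδ, hclose⟩ := Metric.continuousWithinAt_iff.1 (hf s hs) ε hε
  obtain ⟨M, hM⟩ := hK.exists_bound_of_continuousOn hf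
  have hM0 : 0 ≤ M := (norm_nonneg _).trans (hM s hs)
  refine ⟨2 * M / δ ^ 2, by positivity, fun t ht => ?_⟩
  rcases lt_or_ge (dist t s) δ with h | h
  · have := hclose ht h
    rw [Real.dist_eq] at this
    have : 0 ≤ 2 * M / δ ^ 2 * ‖t - s‖ ^ 2 := by positivity
    linarith
  · rw [dist_eq_norm] at h
    have h1 : |f t - f s| ≤ 2 * M := by
      have a1 := hM t ht
      have a2 := hM s hs
      rw [Real.norm_eq_abs] at a1 a2
      exact (abs_sub _ _).trans (by linarith)
    have h2 : 2 * M ≤ 2 * M / δ ^ 2 * ‖t - s‖ ^ 2 := by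
      rw [div_mul_eq_mul_div, le_div_iff₀ (by positivity)]
      gcongr
    linarith

/-- The Dirichlet problem off an interval is solved by transporting the boundary data to the unit
circle and taking the Poisson integral. -/
theorem solvesDirichlet_interval (hbc : b < c) {f : ℂ → ℝ} (hf : ContinuousOn f (interval b c)) :
    SolvesDirichlet (interval b c) f
      (fun q => poissonIntegral (fun ζ => f (arcPoint b c ζ)) (discMap b c q)) := by
  have hg := continuousOn_comp_arcPoint hbc hf
  refine ⟨fun q hq => ?_, ?_⟩
  · obtain ⟨F, hF, hFe⟩ := exists_analytic_re_eq_poissonIntegral hg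
    refine ((analyticAtSphere_discMap hbc hq).harmonic_re_comp
      (hF _ (discMap_mem_ball hbc hq))).congr ?_
    filter_upwards [(isOpen_sphereCompl (isCompact_interval b c)).mem_nhds hq] with p hp
    exact (hFe _ (discMap_mem_ball hbc hp)).symm
  · rintro _ ⟨s, hs, rfl⟩
    rw [Metric.tendsto_nhds]
    intro η hη
    obtain ⟨C, hC0, hC⟩ := exists_quadratic_bound (isCompact_interval b c) hf
      (ofReal_mem_interval.2 hs) (half_pos hη)
    have hcb : 0 < c - b := by linarith
    -- the real part of `F` on the unit circle is `η / 2 + C * ‖arcPoint b c ζ - s‖ ^ 2`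
    set m : ℝ := (b + c) / 2 - s with hm
    set h : ℝ := (c - b) / 2 with hh
    have hh0 : 0 < h := by positivity
    set F : ℂ → ℂ := fun ζ =>
      (η / 2 : ℝ) + (C : ℂ) * (m ^ 2 + 2 * m * h * ζ + h ^ 2 / 2 * (1 + ζ ^ 2)) with hF
    have hFd : Differentiable ℂ F := by fun_prop
    have hFre : ∀ ζ : ℂ, (F ζ).re =
        η / 2 + C * (m ^ 2 + 2 * m * h * ζ.re + h ^ 2 / 2 * (1 + (2 * ζ.re ^ 2 - ‖ζ‖ ^ 2))) := by
      intro ζ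
      have h2 : ‖ζ‖ ^ 2 = ζ.re ^ 2 + ζ.im ^ 2 := by
        rw [← Complex.normSq_eq_norm_sq, Complex.normSq_apply]; ring
      have e : F ζ = ((η / 2 : ℝ) : ℂ) + (C : ℂ) * (((m ^ 2 : ℝ) : ℂ) + ((2 * m * h : ℝ) : ℂ) * ζ +
          ((h ^ 2 / 2 : ℝ) : ℂ) * (1 + ζ ^ 2)) := by
        simp [hF]
      rw [e, h2]
      have e' : (ζ ^ 2).re = ζ.re ^ 2 - ζ.im ^ 2 := by rw [pow_two, Complex.mul_re]; ring
      simp only [Complex.add_re, Complex.re_ofReal_mul, Complex.ofReal_re, Complex.one_re, e']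
      ring
    have hbound : ∀ z ∉ interval b c,
        |poissonIntegral (fun ζ => f (arcPoint b c ζ)) (discMap b c z) - f s| ≤
          (F (discMap b c z)).re := by
      intro z hz
      refine abs_poissonIntegral_sub_le hg hFd (discMap_mem_ball hbc (coe_mem_sphereCompl.2 hz)) ?_
      intro ζ hζ
      have h1 := hC _ (arcPoint_mem hbc hζ)
      rw [hFre, mem_sphere_zero_iff_norm.1 hζ]
      have h3 : ‖arcPoint b c ζ - s‖ ^ 2 = (m + h * ζ.re) ^ 2 := by
        rw [arcPoint, ← Complex.ofReal_sub, Complex.norm_real, Real.norm_eq_abs, sq_abs]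
        simp only [hm, hh]; ring
      rw [h3] at h1
      refine h1.trans (le_of_eq ?_)
      ring
    have hlim : Tendsto (fun z : ℂ => (F (discMap b c z)).re) (𝓝[(interval b c)ᶜ] (s : ℂ))
        (𝓝 (η / 2)) := by
      have t1 := tendsto_norm_discMap hbc hs
      have t2 := tendsto_re_discMap hbc hs
      have e2 : 2 * (s - (b + c) / 2) / (c - b) = -m / h := by
        simp only [hm, hh]; field_simp; ring
      rw [e2] at t2
      have t3 := (((t2.const_mul (2 * m * h)).const_add (m ^ 2)).add
        (((((t2.pow 2).const_mul 2).sub (t1.pow 2)).const_add 1).const_mul (h ^ 2 / 2))).const_mul C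
      have t4 := t3.const_add (η / 2)
      have e4 : η / 2 + C * (m ^ 2 + 2 * m * h * (-m / h) +
          h ^ 2 / 2 * (1 + (2 * (-m / h) ^ 2 - 1 ^ 2))) = η / 2 := by
        field_simp; ring
      rw [e4] at t4
      exact t4.congr fun z => (hFre _).symm
    filter_upwards [self_mem_nhdsWithin, hlim.eventually (gt_mem_nhds (half_lt_self hη))] with z hz hz2
    rw [Real.dist_eq]
    exact (hbound z hz).trans_lt hz2

/-- Harnack's inequality off an interval, with reference point `∞`. -/
theorem harnack_interval (hbc : b < c) {K : Set ℂ} (hK : IsCompact K)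
    (hdisj : Disjoint K (interval b c)) : ∃ κ : ℝ, 0 < κ ∧ κ ≤ 1 ∧ ∀ (f : ℂ → ℝ)
      (u : OnePoint ℂ → ℝ), ContinuousOn f (interval b c) → (∀ x ∈ interval b c, 0 ≤ f x) →
      SolvesDirichlet (interval b c) f u → ∀ z ∈ K, κ * u OnePoint.infty ≤ u z := by
  have hoff : ∀ z ∈ K, (z : OnePoint ℂ) ∈ sphereCompl (interval b c) := fun z hz =>
    coe_mem_sphereCompl.2 (disjoint_left.1 hdisj hz)
  rcases K.eq_empty_or_nonempty with rfl | hne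
  · exact ⟨1, one_pos, le_rfl, by simp⟩
  have hcont : ContinuousOn (fun z : ℂ => ‖discMap b c z‖) K := fun z hz =>
    (show AnalyticAt ℂ (fun z : ℂ => discMap b c z) z from
      analyticAtSphere_discMap hbc (hoff z hz)).continuousAt.norm.continuousWithinAt
  obtain ⟨z₀, hz₀, hmax⟩ := hK.exists_isMaxOn hne hcont
  set r := ‖discMap b c z₀‖
  have hr1 : r < 1 := norm_discMap_lt_one hbc (hoff z₀ hz₀)
  have hr0 : 0 ≤ r := norm_nonneg _
  refine ⟨(1 - r) / (1 + r), div_pos (by linarith) (by linarith),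
    (div_le_one (by linarith)).2 (by linarith), fun f u hf hf0 hu z hz => ?_⟩
  have hne' : (interval b c).Nonempty := ⟨b, ofReal_mem_interval.2 ⟨le_rfl, hbc.le⟩⟩
  have hun := hu.unique (solvesDirichlet_interval hbc hf) (isCompact_interval b c) hne'
    fun _ _ => rfl
  have hg := continuousOn_comp_arcPoint hbc hf
  have hav : u OnePoint.infty = Real.circleAverage (fun ζ => f (arcPoint b c ζ)) 0 1 := by
    rw [hun _ (infty_mem_sphereCompl _), discMap_infty, poissonIntegral_zero]
  rw [hun _ (hoff z hz), hav]
  have h1 := harnack_poissonIntegral hg (discMap_mem_ball hbc (hoff z hz))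
    fun ζ hζ => hf0 _ (arcPoint_mem hbc hζ)
  refine le_trans ?_ h1
  have hA : 0 ≤ Real.circleAverage (fun ζ => f (arcPoint b c ζ)) 0 1 := by
    refine Real.circleAverage_nonneg_of_nonneg fun ζ hζ => hf0 _ (arcPoint_mem hbc ?_)
    rwa [abs_one] at hζ
  have hle : ‖discMap b c z‖ ≤ r := hmax hz
  have : (1 - r) / (1 + r) ≤ (1 - ‖discMap b c z‖) / (1 + ‖discMap b c z‖) := by
    have := norm_nonneg (discMap b c z)
    rw [div_le_div_iff₀ (by linarith) (by linarith)]
    nlinarith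
  gcongr

/-- `g` is a Green's function of the complement of `K` with pole at `∞`, and `ρ` is the harmonic
part of `g` at `∞` in the coordinate `w = 1 / z`. -/
structure IsGreenAtInfty (K : Set ℂ) (g : OnePoint ℂ → ℝ) (ρ : ℂ → ℝ) : Prop where
  harmonic : ∀ q ∈ sphereCompl K, q ≠ OnePoint.infty → HarmonicAtSphere g q
  boundary : ∀ x ∈ K, Tendsto (fun z : ℂ => g z) (𝓝[Kᶜ] x) (𝓝 0)
  harmonic_part : HarmonicAt ρ 0
  chart : ∀ᶠ w in 𝓝[≠] (0 : ℂ), g (chartInfty w) = -Real.log ‖w‖ + ρ w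

lemma tendsto_norm_discMap_of_mem (hbc : b < c) {x : ℂ} (hx : x ∈ interval b c) :
    Tendsto (fun z : ℂ => ‖discMap b c z‖) (𝓝[(interval b c)ᶜ] x) (𝓝 1) := by
  obtain ⟨s, hs, rfl⟩ := hx
  exact tendsto_norm_discMap hbc hs

theorem exists_isGreenAtInfty_interval (hbc : b < c) :
    ∃ ρ, IsGreenAtInfty (interval b c) (fun q => -Real.log ‖discMap b c q‖) ρ := by
  obtain ⟨k, hk, hk0, hke⟩ := exists_discMap_chartInfty hbc
  refine ⟨fun w => -Real.log ‖k w‖, ?_, ?_, ?_, ?_⟩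
  · intro q hq hqi
    induction q using OnePoint.rec with
    | infty => exact absurd rfl hqi
    | coe z =>
      exact ((analyticAtSphere_discMap hbc hq).harmonic_log_norm_comp (A := fun w => w)
        analyticAt_id (discMap_ne_zero hbc (coe_mem_sphereCompl.1 hq))).neg
  · intro x hx
    have := ((Real.continuousAt_log one_ne_zero).tendsto.comp
      (tendsto_norm_discMap_of_mem hbc hx)).neg
    simpa using this
  · exact (hk.harmonicAt_log_norm hk0).neg
  · filter_upwards [self_mem_nhdsWithin, hke.filter_mono nhdsWithin_le_nhds,
      (hk.continuousAt.eventually_ne hk0).filter_mono nhdsWithin_le_nhds] with w hw h1 h2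
    rw [h1, norm_mul, Real.log_mul (norm_ne_zero_iff.2 hw) (norm_ne_zero_iff.2 h2)]
    ring

/-- The Green's function of the complement of an interval with a finite pole `p` is the logarithm
of a Blaschke factor of `discMap`. -/
theorem exists_isGreenFunction_interval (hbc : b < c) {p : ℂ} (hp : p ∉ interval b c) :
    ∃ G, IsGreenFunction (interval b c) p G ∧
      G OnePoint.infty = -Real.log ‖discMap b c p‖ := by
  set a := discMap b c p with ha
  have hpS : (p : OnePoint ℂ) ∈ sphereCompl (interval b c) := coe_mem_sphereCompl.2 hp
  have ha1 : ‖a‖ < 1 := norm_discMap_lt_one hbc hpS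
  have ha0 : a ≠ 0 := discMap_ne_zero hbc hp
  have hcb : (0 : ℝ) < c - b := by linarith
  have hden : ∀ w : ℂ, ‖w‖ ≤ 1 → 1 - (starRingEnd ℂ) a * w ≠ 0 := by
    intro w hw h
    have h1 : ‖(starRingEnd ℂ) a * w‖ = 1 := by rw [← sub_eq_zero.1 h, norm_one]
    rw [norm_mul, RCLike.norm_conj] at h1
    nlinarith [norm_nonneg a, norm_nonneg w]
  have hinj : ∀ q ∈ sphereCompl (interval b c), q ≠ p → discMap b c q ≠ a := by
    intro q hq hqp h
    induction q using OnePoint.rec with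
    | infty => exact ha0 (by rw [← h, discMap_infty])
    | coe z =>
      have h1 := joukowski_discMap hbc (coe_mem_sphereCompl.1 hq)
      have h2 := joukowski_discMap hbc hp
      rw [h] at h1
      rw [← ha] at h2
      have h3 : (z - p) * (4 * a) = 0 := by linear_combination h1 - h2
      rcases mul_eq_zero.1 h3 with h4 | h4
      · exact hqp (by rw [sub_eq_zero.1 h4])
      · simp [ha0] at h4
  refine ⟨fun q => Real.log ‖1 - (starRingEnd ℂ) a * discMap b c q‖ -
    Real.log ‖discMap b c q - a‖, ⟨?_, ?_, ?_⟩, ?_⟩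
  · intro q hq hqp
    have hA := analyticAtSphere_discMap hbc hq
    refine (hA.harmonic_log_norm_comp (A := fun w => 1 - (starRingEnd ℂ) a * w) (by fun_prop)
      (hden _ (norm_discMap_lt_one hbc hq).le)).sub
      (hA.harmonic_log_norm_comp (A := fun w => w - a) (by fun_prop) ?_)
    exact sub_ne_zero.2 (hinj q hq hqp)
  · -- `‖w - a‖` is `‖z - p‖` up to the factor `(c - b) / 4 * ‖1 - 1 / (w * a)‖`
    have hcont : ContinuousAt (fun z : ℂ => discMap b c z) p :=
      (show AnalyticAt ℂ (fun z : ℂ => discMap b c z) p from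
        analyticAtSphere_discMap hbc hpS).continuousAt
    have hne1 : a * a - 1 ≠ 0 := by
      intro h
      have : ‖a * a‖ = 1 := by rw [sub_eq_zero.1 h, norm_one]
      rw [norm_mul] at this
      nlinarith [norm_nonneg a]
    have hlim : ContinuousAt (fun z : ℂ => Real.log ‖1 - (starRingEnd ℂ) a * discMap b c z‖ +
        Real.log ((c - b) * ‖discMap b c z * a - 1‖ / (4 * ‖discMap b c z‖ * ‖a‖))) p := by
      have e1 : ContinuousAt (fun z : ℂ => ‖1 - (starRingEnd ℂ) a * discMap b c z‖) p :=
        (continuousAt_const.sub (continuousAt_const.mul hcont)).norm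
      have e2 : ContinuousAt (fun z : ℂ => (c - b) * ‖discMap b c z * a - 1‖ /
          (4 * ‖discMap b c z‖ * ‖a‖)) p := by
        refine ContinuousAt.div (continuousAt_const.mul ((hcont.mul_const a).sub_const 1).norm)
          ((continuousAt_const.mul hcont.norm).mul_const _) ?_
        rw [← ha]
        have := norm_pos_iff.2 ha0
        positivity
      refine (e1.log (norm_ne_zero_iff.2 (hden _ ha1.le))).add (e2.log ?_)
      rw [← ha]
      have h1 := norm_pos_iff.2 ha0
      have h2 := norm_pos_iff.2 hne1
      positivity
    refine ⟨_, (hlim.tendsto.mono_left nhdsWithin_le_nhds).congr' ?_⟩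
    have hoff : ∀ᶠ z in 𝓝[≠] p, z ∉ interval b c :=
      nhdsWithin_le_nhds ((isCompact_interval b c).isClosed.isOpen_compl.mem_nhds hp)
    have hne2 : ∀ᶠ z : ℂ in 𝓝[≠] p, discMap b c z * a - 1 ≠ 0 :=
      (((hcont.mul_const a).sub_const 1).eventually_ne hne1).filter_mono nhdsWithin_le_nhds
    filter_upwards [hoff, hne2, self_mem_nhdsWithin] with z hz h2 hzp
    have hw0 := norm_pos_iff.2 (discMap_ne_zero hbc hz)
    have ha0' := norm_pos_iff.2 ha0
    have hwa : discMap b c z - a ≠ 0 := sub_ne_zero.2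
      (hinj z (coe_mem_sphereCompl.2 hz) (by simpa using hzp))
    have e1 := joukowski_discMap hbc hz
    have e2 := joukowski_discMap hbc hp
    rw [← ha] at e2
    have e3 : 4 * discMap b c z * a * (z - p) =
        (c - b) * (discMap b c z - a) * (discMap b c z * a - 1) := by
      linear_combination a * e1 - discMap b c z * e2
    have hcbn : ‖(c : ℂ) - b‖ = c - b := by
      rw [← Complex.ofReal_sub, Complex.norm_real, Real.norm_of_nonneg hcb.le]
    have e4 := congrArg norm e3
    simp only [norm_mul, hcbn, RCLike.norm_ofNat] at e4
    have e5 : ‖z - p‖ = ‖discMap b c z - a‖ * ((c - b) * ‖discMap b c z * a - 1‖ /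
        (4 * ‖discMap b c z‖ * ‖a‖)) := by
      field_simp
      linear_combination e4
    have h2' := norm_pos_iff.2 h2
    rw [e5, Real.log_mul (norm_ne_zero_iff.2 hwa) (by positivity)]
    ring
  · intro x hx
    have hre := tendsto_norm_discMap_of_mem hbc hx
    -- `‖1 - conj a * w‖ ^ 2 - ‖w - a‖ ^ 2 = (1 - ‖a‖ ^ 2) * (1 - ‖w‖ ^ 2)` tends to `0`
    have hid : ∀ w : ℂ, ‖1 - (starRingEnd ℂ) a * w‖ ^ 2 =
        ‖w - a‖ ^ 2 + (1 - ‖a‖ ^ 2) * (1 - ‖w‖ ^ 2) := by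
      intro w
      simp only [← Complex.normSq_eq_norm_sq, Complex.normSq_apply, Complex.sub_re, Complex.sub_im,
        Complex.mul_re, Complex.mul_im, Complex.one_re, Complex.one_im, Complex.conj_re,
        Complex.conj_im]
      ring
    have hlow : ∀ᶠ z : ℂ in 𝓝[(interval b c)ᶜ] x, (1 - ‖a‖) / 2 ≤ ‖discMap b c z - a‖ := by
      filter_upwards [hre.eventually (lt_mem_nhds (show (1 + ‖a‖) / 2 < 1 by linarith))] with z hz
      have := norm_sub_norm_le (discMap b c z) a
      linarith
    have hq : Tendsto (fun z : ℂ => (1 - ‖a‖ ^ 2) * (1 - ‖discMap b c z‖ ^ 2) /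
        ‖discMap b c z - a‖ ^ 2) (𝓝[(interval b c)ᶜ] x) (𝓝 0) := by
      have hup : Tendsto (fun z : ℂ => (1 - ‖a‖ ^ 2) * (1 - ‖discMap b c z‖ ^ 2) /
        ((1 - ‖a‖) / 2) ^ 2) (𝓝[(interval b c)ᶜ] x) (𝓝 0) := by
        have := (((hre.pow 2).const_sub 1).const_mul (1 - ‖a‖ ^ 2)).div_const (((1 - ‖a‖) / 2) ^ 2)
        simpa using this
      refine squeeze_zero' ?_ ?_ hup
      · filter_upwards [self_mem_nhdsWithin] with z hz
        have := norm_discMap_lt_one hbc (coe_mem_sphereCompl.2 hz)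
        have h1 : 0 ≤ 1 - ‖discMap b c z‖ ^ 2 := by nlinarith [norm_nonneg (discMap b c z)]
        have h2 : 0 ≤ 1 - ‖a‖ ^ 2 := by nlinarith [norm_nonneg a]
        positivity
      · filter_upwards [self_mem_nhdsWithin, hlow] with z hz hz2
        have := norm_discMap_lt_one hbc (coe_mem_sphereCompl.2 hz)
        have h1 : 0 ≤ 1 - ‖discMap b c z‖ ^ 2 := by nlinarith [norm_nonneg (discMap b c z)]
        have h2 : 0 ≤ 1 - ‖a‖ ^ 2 := by nlinarith [norm_nonneg a]
        have h3 : 0 < (1 - ‖a‖) / 2 := by linarith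
        gcongr
    have hl : Tendsto (fun z : ℂ => 1 / 2 * Real.log (1 + (1 - ‖a‖ ^ 2) *
        (1 - ‖discMap b c z‖ ^ 2) / ‖discMap b c z - a‖ ^ 2)) (𝓝[(interval b c)ᶜ] x) (𝓝 0) := by
      have h1 : Tendsto (fun t : ℝ => 1 / 2 * Real.log (1 + t)) (𝓝 0) (𝓝 0) := by
        have : ContinuousAt (fun t : ℝ => 1 / 2 * Real.log (1 + t)) 0 :=
          continuousAt_const.mul ((continuousAt_const.add continuousAt_id).log (by simp))
        simpa using this.tendsto
      exact h1.comp hq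
    refine hl.congr' ?_
    filter_upwards [self_mem_nhdsWithin, hlow] with z hz hz2
    have h3 : 0 < ‖discMap b c z - a‖ := by linarith
    have h4 : 0 < ‖1 - (starRingEnd ℂ) a * discMap b c z‖ := norm_pos_iff.2
      (hden _ (norm_discMap_lt_one hbc (coe_mem_sphereCompl.2 hz)).le)
    have h5 : 1 + (1 - ‖a‖ ^ 2) * (1 - ‖discMap b c z‖ ^ 2) / ‖discMap b c z - a‖ ^ 2 =
        (‖1 - (starRingEnd ℂ) a * discMap b c z‖ / ‖discMap b c z - a‖) ^ 2 := by
      rw [div_pow, hid]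
      field_simp
    rw [h5, Real.log_pow, Real.log_div h4.ne' h3.ne']
    push_cast
    ring
  · simp [discMap_infty]

end Interval

/-! ### Green's functions with pole at infinity -/

lemma tendsto_neg_log_norm : Tendsto (fun w : ℂ => -Real.log ‖w‖) (𝓝[≠] 0) atTop :=
  tendsto_neg_atBot_atTop.comp (Real.tendsto_log_nhdsGT_zero.comp tendsto_norm_nhdsNE_zero)

/-- A function on the plane which near `∞` is given by a function `r` harmonic in the coordinate
`1 / z` extends harmonically to `∞`. -/
lemma exists_harmonic_extension_infty {u : OnePoint ℂ → ℝ} {r : ℂ → ℝ} (hr : HarmonicAt r 0)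
    (h : ∀ᶠ w in 𝓝[≠] (0 : ℂ), u (chartInfty w) = r w) :
    ∃ d : OnePoint ℂ → ℝ, (∀ z : ℂ, d z = u z) ∧ d OnePoint.infty = r 0 ∧
      HarmonicAtSphere d OnePoint.infty := by
  refine ⟨fun q => Option.elim q (r 0) fun z => u z, fun z => rfl, rfl, ?_⟩
  rw [harmonicAtSphere_infty]
  refine (harmonicAt_congr_nhds ?_).1 hr
  rw [eventually_nhdsWithin_iff] at h
  filter_upwards [h] with w hw
  by_cases h0 : w = 0
  · subst h0
    rw [chartInfty_zero]; rfl
  · rw [← hw h0, chartInfty_of_ne h0]; rfl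

namespace IsGreenAtInfty

variable {K : Set ℂ} {g : OnePoint ℂ → ℝ} {ρ : ℂ → ℝ}

lemma tendsto_atTop (hg : IsGreenAtInfty K g ρ) :
    Tendsto g (𝓝[≠] OnePoint.infty) atTop := by
  rw [← map_chartInfty_nhdsNE, tendsto_map'_iff]
  have h1 : Tendsto ρ (𝓝[≠] 0) (𝓝 (ρ 0)) :=
    hg.harmonic_part.1.continuousAt.tendsto.mono_left nhdsWithin_le_nhds
  refine (tendsto_neg_log_norm.atTop_add h1).congr' ?_
  filter_upwards [hg.chart] with w hw
  exact hw.symm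

/-- Minimum principle for a function bounded below near `∞`. -/
lemma nonneg_of_boundary (hg : IsGreenAtInfty K g ρ) (hK : IsCompact K) {u : OnePoint ℂ → ℝ}
    (hu : ∀ q ∈ sphereCompl K, q ≠ OnePoint.infty → HarmonicAtSphere u q)
    (hb : ∀ x ∈ K, ∀ ε > 0, ∀ᶠ z : ℂ in 𝓝[Kᶜ] x, -ε < u z)
    (hbdd : ∃ C, ∀ᶠ q in 𝓝[≠] OnePoint.infty, C ≤ u q) : ∀ z ∉ K, 0 ≤ u (z : ℂ) := fun z hz =>
  nonneg_of_boundary_of_pole hK (infty_mem_sphereCompl K) hu hb hbdd hg.harmonic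
    (fun x hx => eventually_neg_lt_of_tendsto (hg.boundary x hx) le_rfl) hg.tendsto_atTop z
    (coe_mem_sphereCompl.2 hz) (OnePoint.coe_ne_infty z)

lemma continuousAt (hg : IsGreenAtInfty K g ρ) {z : ℂ} (hz : z ∉ K) :
    ContinuousAt (fun z : ℂ => g z) z :=
  (hg.harmonic z (coe_mem_sphereCompl.2 hz) (OnePoint.coe_ne_infty z)).1.continuousAt

/-- The Robin constant is the constant term of `g` at `∞`. -/
lemma tendsto_sub_log (hg : IsGreenAtInfty K g ρ) :
    Tendsto (fun z : ℂ => g z - Real.log ‖z‖) (Bornology.cobounded ℂ) (𝓝 (ρ 0)) := by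
  have h1 : Tendsto (fun w => g (chartInfty w) + Real.log ‖w‖) (𝓝[≠] 0) (𝓝 (ρ 0)) := by
    refine (hg.harmonic_part.1.continuousAt.tendsto.mono_left nhdsWithin_le_nhds).congr' ?_
    filter_upwards [hg.chart] with w hw
    rw [hw]; ring
  refine (h1.comp tendsto_inv₀_cobounded').congr' ?_
  filter_upwards [Bornology.eventually_ne_cobounded (0 : ℂ)] with z hz
  simp [chartInfty_of_ne (inv_ne_zero hz), sub_eq_add_neg]

lemma isGreenFunction (hg : IsGreenAtInfty K g ρ) : IsGreenFunction K OnePoint.infty g :=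
  ⟨hg.harmonic, ⟨_, hg.tendsto_sub_log⟩, hg.boundary⟩

/-- The poles of two Green's functions cancel. -/
lemma exists_sub {K' : Set ℂ} {g' : OnePoint ℂ → ℝ} {ρ' : ℂ → ℝ} (hg : IsGreenAtInfty K g ρ)
    (hg' : IsGreenAtInfty K' g' ρ') : ∃ d : OnePoint ℂ → ℝ, (∀ z : ℂ, d z = g z - g' z) ∧
      HarmonicAtSphere d OnePoint.infty := by
  obtain ⟨d, hd, -, h⟩ := exists_harmonic_extension_infty (u := fun q => g q - g' q)
    (hg.harmonic_part.sub hg'.harmonic_part) (by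
      filter_upwards [hg.chart, hg'.chart] with w h1 h2
      rw [h1, h2, Pi.sub_apply]; ring)
  exact ⟨d, hd, h⟩

end IsGreenAtInfty

/-! ### Solvability of the Dirichlet problem for finite unions of intervals -/

/-- A compact set for which the Dirichlet problem is solvable for all continuous boundary data, and
whose complement has a Green's function with pole at `∞`. -/
structure IsRegularCompact (K : Set ℂ) : Prop where
  isCompact : IsCompact K
  nonempty : K.Nonempty
  dirichlet : ∀ f : ℂ → ℝ, ContinuousOn f K → ∃ u, SolvesDirichlet K f u
  green : ∃ g ρ, IsGreenAtInfty K g ρ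

lemma isRegularCompact_interval {b c : ℝ} (hbc : b < c) : IsRegularCompact (interval b c) where
  isCompact := isCompact_interval b c
  nonempty := ⟨b, ofReal_mem_interval.2 ⟨le_rfl, hbc.le⟩⟩
  dirichlet _ hf := ⟨_, solvesDirichlet_interval hbc hf⟩
  green := let ⟨ρ, hρ⟩ := exists_isGreenAtInfty_interval hbc; ⟨_, ρ, hρ⟩

section Union

variable {K : Set ℂ} {b c : ℝ}

/-- The alternating method: the Dirichlet problem on the complement of `K ∪ [b, c]` is solvable after
subtracting a suitable constant from the data on `[b, c]`. The solution is a sum `p + r` of functions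
harmonic off `[b, c]` and off `K`. Transferring data from `[b, c]` to `K` and back is a contraction
once the multiple `κ * p ∞` of the value at `∞` is taken out, by Harnack's inequality. -/
lemma exists_dirichlet_union_sub_const (hK : IsRegularCompact K) (hbc : b < c)
    (hdisj : Disjoint K (interval b c)) {φ : ℂ → ℝ} (hφK : ContinuousOn φ K)
    (hφJ : ContinuousOn φ (interval b c)) :
    ∃ (s : ℝ) (f h : ℂ → ℝ) (p r : OnePoint ℂ → ℝ), SolvesDirichlet (interval b c) h p ∧
      SolvesDirichlet K f r ∧ (∀ x ∈ K, f x + p x = φ x) ∧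
      ∀ x ∈ interval b c, h x + r x = φ x - s := by
  set J := interval b c with hJ
  have hJr := isRegularCompact_interval hbc
  rw [← hJ] at hJr
  have hKJ : ∀ x ∈ K, x ∉ J := fun x hx => disjoint_left.1 hdisj hx
  have hJK : ∀ x ∈ J, x ∉ K := fun x hx => disjoint_right.1 hdisj hx
  have : CompactSpace J := isCompact_iff_compactSpace.1 hJr.isCompact
  obtain ⟨κ, hκ0, hκ1, hharn⟩ := harnack_interval hbc hK.isCompact hdisj
  rw [← hJ] at hharn
  let ext : C(J, ℝ) → ℂ → ℝ := fun h => Function.extend Subtype.val h 0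
  have hext : ∀ (h : C(J, ℝ)) (x : J), ext h x = h x := fun h x =>
    Subtype.val_injective.extend_apply _ _ _
  have hextc : ∀ h : C(J, ℝ), ContinuousOn (ext h) J := fun h => by
    rw [continuousOn_iff_continuous_domRestrict]
    exact h.continuous.congr fun x => (hext h x).symm
  choose P hP using fun h : C(J, ℝ) => hJr.dirichlet (ext h) (hextc h)
  have hPc : ∀ h, ContinuousOn (fun z : ℂ => P h z) K := fun h z hz =>
    ((hP h).continuousAt (hKJ z hz)).continuousWithinAt
  choose R hR using fun h : C(J, ℝ) => hK.dirichlet (fun z : ℂ => P h z) (hPc h)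
  obtain ⟨U, hU⟩ := hK.dirichlet φ hφK
  have hRc : ∀ {f : ℂ → ℝ} {r : OnePoint ℂ → ℝ}, SolvesDirichlet K f r →
      Continuous fun x : J => r (x : ℂ) := fun {f r} hr =>
    continuous_iff_continuousAt.2 fun x => ContinuousAt.comp (f := fun x : J => (x : ℂ))
      (g := fun z : ℂ => r z) (hr.continuousAt (hJK x x.2)) continuous_subtype_val.continuousAt
  have hφJ' : Continuous fun x : J => φ x := by
    rw [continuousOn_iff_continuous_domRestrict] at hφJ
    exact hφJ
  let T : C(J, ℝ) → C(J, ℝ) := fun h =>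
    ⟨fun x => φ x - U (x : ℂ) + (R h (x : ℂ) - κ * P h OnePoint.infty),
      (hφJ'.sub (hRc hU)).add ((hRc (hR h)).sub continuous_const)⟩
  obtain ⟨k, hk⟩ : ∃ k : NNReal, (k : ℝ) = 1 - κ := ⟨⟨1 - κ, by linarith⟩, rfl⟩
  have hT : ContractingWith k T := by
    refine ⟨?_, LipschitzWith.of_dist_le_mul fun h₁ h₂ => ?_⟩
    · rw [← NNReal.coe_lt_coe, hk]
      simpa using hκ0
    rw [hk]
    have hD0 : 0 ≤ dist h₁ h₂ := dist_nonneg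
    set D := dist h₁ h₂ with hD
    have hpd := (hP h₁).sub (hP h₂)
    have hdle : ∀ x ∈ J, |ext h₁ x - ext h₂ x| ≤ D := by
      intro x hx
      have := ContinuousMap.dist_apply_le_dist (f := h₁) (g := h₂) ⟨x, hx⟩
      rw [Real.dist_eq] at this
      rwa [hext h₁ ⟨x, hx⟩, hext h₂ ⟨x, hx⟩]
    set m := P h₁ OnePoint.infty - P h₂ OnePoint.infty with hm
    have hdc : ContinuousOn (fun x => ext h₁ x - ext h₂ x) J := (hextc h₁).sub (hextc h₂)
    have hKb : ∀ z ∈ K, |P h₁ z - P h₂ z - κ * m| ≤ (1 - κ) * D := by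
      intro z hz
      have h1 := hharn (fun x => D + (ext h₁ x - ext h₂ x)) _ (continuousOn_const.add hdc)
        (fun x hx => by have := (abs_le.1 (hdle x hx)).1; linarith)
        ((SolvesDirichlet.const J D).add hpd) z hz
      have h2 := hharn (fun x => D - (ext h₁ x - ext h₂ x)) _ (continuousOn_const.sub hdc)
        (fun x hx => by have := (abs_le.1 (hdle x hx)).2; linarith)
        ((SolvesDirichlet.const J D).sub hpd) z hz
      rw [← hm] at h1 h2
      rw [abs_le]
      constructor <;> linarith
    have hJb := (((hR h₁).sub (hR h₂)).sub (SolvesDirichlet.const K (κ * m))).abs_le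
      hK.isCompact hK.nonempty hKb
    rw [ContinuousMap.dist_le (mul_nonneg (by linarith) hD0)]
    intro x
    have := hJb (x : ℂ) (coe_mem_sphereCompl.2 (hJK x x.2))
    rw [Real.dist_eq]
    convert this using 2
    simp only [T, ContinuousMap.coe_mk, hm]
    ring
  obtain ⟨h, hfix⟩ : ∃ h, T h = h := ⟨_, hT.fixedPoint_isFixedPt⟩
  refine ⟨κ * P h OnePoint.infty, _, ext h, P h, _, hP h, hU.sub (hR h), fun x hx => by ring,
    fun x hx => ?_⟩
  have := congrArg (fun k : C(J, ℝ) => k ⟨x, hx⟩) hfix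
  simp only [T, ContinuousMap.coe_mk] at this
  rw [hext h ⟨x, hx⟩, ← this]
  ring

lemma nhdsWithin_compl_union_le_left (x : ℂ) (s t : Set ℂ) : 𝓝[(s ∪ t)ᶜ] x ≤ 𝓝[sᶜ] x :=
  nhdsWithin_mono _ (compl_subset_compl.2 subset_union_left)

lemma nhdsWithin_compl_union_le_right (x : ℂ) (s t : Set ℂ) : 𝓝[(s ∪ t)ᶜ] x ≤ 𝓝[tᶜ] x :=
  nhdsWithin_mono _ (compl_subset_compl.2 subset_union_right)

lemma solvesDirichlet_union_add (hdisj : Disjoint K (interval b c)) {f h : ℂ → ℝ}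
    {p r : OnePoint ℂ → ℝ} (hp : SolvesDirichlet (interval b c) h p) (hr : SolvesDirichlet K f r) :
    ∀ {φ : ℂ → ℝ}, (∀ x ∈ K, f x + p x = φ x) → (∀ x ∈ interval b c, h x + r x = φ x) →
      SolvesDirichlet (K ∪ interval b c) φ (fun q => p q + r q) := by
  intro φ hφK hφJ
  refine ⟨fun q hq => (hp.harmonic q (sphereCompl_anti subset_union_right hq)).add
    (hr.harmonic q (sphereCompl_anti subset_union_left hq)), ?_⟩
  rintro x (hx | hx)
  · rw [← hφK x hx, add_comm]
    exact ((hp.continuousAt (disjoint_left.1 hdisj hx)).tendsto.mono_left nhdsWithin_le_nhds).add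
      ((hr.boundary x hx).mono_left (nhdsWithin_compl_union_le_left x _ _))
  · rw [← hφJ x hx]
    exact ((hp.boundary x hx).mono_left (nhdsWithin_compl_union_le_right x _ _)).add
      ((hr.continuousAt (disjoint_right.1 hdisj hx)).tendsto.mono_left nhdsWithin_le_nhds)

open Classical in
lemma continuousOn_piecewise_union {J : Set ℂ} (hK : IsCompact K) (hJ : IsCompact J)
    (hdisj : Disjoint K J) {f₁ f₂ : ℂ → ℝ} (h₁ : ContinuousOn f₁ J) (h₂ : ContinuousOn f₂ K) :
    ContinuousOn (J.piecewise f₁ f₂) (K ∪ J) := by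
  refine ContinuousOn.union_of_isClosed ?_ ?_ hK.isClosed hJ.isClosed
  · exact h₂.congr fun x hx => piecewise_eq_of_notMem _ _ _ (disjoint_left.1 hdisj hx)
  · exact h₁.congr fun x hx => piecewise_eq_of_mem _ _ _ hx

open Classical in
/-- Existence of the harmonic measure of `[b, c]` in the complement of `K ∪ [b, c]`. If the constant
produced by the alternating method for the data of the difference of the Green's functions of
`[b, c]` and `K` were zero, that difference would be `p + r`, and the Green's function of `[b, c]`
minus `p` would extend to a harmonic function on `ℂ` tending to `+∞` at `∞`. -/
lemma exists_harmonicMeasure_union (hK : IsRegularCompact K) (hbc : b < c)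
    (hdisj : Disjoint K (interval b c)) :
    ∃ χ, SolvesDirichlet (K ∪ interval b c) ((interval b c).piecewise (fun _ => 1) fun _ => 0) χ := by
  set J := interval b c with hJ
  have hJr := isRegularCompact_interval hbc
  rw [← hJ] at hJr
  have hKJ : ∀ x ∈ K, x ∉ J := fun x hx => disjoint_left.1 hdisj hx
  have hJK : ∀ x ∈ J, x ∉ K := fun x hx => disjoint_right.1 hdisj hx
  obtain ⟨gK, ρK, hgK⟩ := hK.green
  obtain ⟨gJ, ρJ, hgJ⟩ := hJr.green
  have hcK : ContinuousOn (fun z : ℂ => gJ z) K := fun z hz =>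
    (hgJ.continuousAt (hKJ z hz)).continuousWithinAt
  have hcJ : ContinuousOn (fun z : ℂ => -gK z) J := fun z hz =>
    (hgK.continuousAt (hJK z hz)).neg.continuousWithinAt
  have hpc := continuousOn_piecewise_union hK.isCompact hJr.isCompact hdisj hcJ hcK
  obtain ⟨s, f, h, p, r, hp, hr, e1, e2⟩ := exists_dirichlet_union_sub_const hK hbc hdisj
    (hpc.mono subset_union_left) (hpc.mono subset_union_right)
  rw [← hJ] at hp e2
  obtain ⟨d, hd, hdinf⟩ := hgJ.exists_sub hgK
  have hdb : SolvesDirichlet (K ∪ J) (J.piecewise (fun z : ℂ => -gK z) fun z : ℂ => gJ z) d := by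
    refine ⟨fun q hq => ?_, ?_⟩
    · induction q using OnePoint.rec with
      | infty => exact hdinf
      | coe z =>
        have := (hgJ.harmonic z (sphereCompl_anti subset_union_right hq)
          (OnePoint.coe_ne_infty z)).sub (hgK.harmonic z (sphereCompl_anti subset_union_left hq)
          (OnePoint.coe_ne_infty z))
        rw [harmonicAtSphere_coe] at this ⊢
        simpa only [hd] using this
    · rintro x (hx | hx)
      · rw [piecewise_eq_of_notMem _ _ _ (hKJ x hx)]
        have := ((hgJ.continuousAt (hKJ x hx)).tendsto.mono_left nhdsWithin_le_nhds).sub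
          ((hgK.boundary x hx).mono_left (nhdsWithin_compl_union_le_left x K J))
        simpa only [hd, sub_zero] using this
      · rw [piecewise_eq_of_mem _ _ _ hx]
        have := ((hgJ.boundary x hx).mono_left (nhdsWithin_compl_union_le_right x K J)).sub
          ((hgK.continuousAt (hJK x hx)).tendsto.mono_left nhdsWithin_le_nhds)
        simpa only [hd, zero_sub] using this
  have hpr : SolvesDirichlet (K ∪ J)
      (fun x => J.piecewise (fun z : ℂ => -gK z) (fun z : ℂ => gJ z) x -
        s * J.piecewise (fun _ => (1 : ℝ)) (fun _ => 0) x) (fun q => p q + r q) :=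
    solvesDirichlet_union_add hdisj hp hr
      (fun x hx => by rw [e1 x hx, piecewise_eq_of_notMem _ (fun _ => (1 : ℝ)) _ (hKJ x hx)]; simp)
      (fun x hx => by rw [e2 x hx, piecewise_eq_of_mem _ (fun _ => (1 : ℝ)) _ hx]; simp)
  by_cases hs : s = 0
  · exfalso
    have heq : ∀ z : ℂ, z ∉ K → z ∉ J → gJ z - p z = gK z + r z := by
      intro z hzK hzJ
      have := hdb.unique hpr (hK.isCompact.union hJr.isCompact) (hK.nonempty.mono subset_union_left)
        (fun x _ => by simp [hs]) z (coe_mem_sphereCompl.2 (by simp [hzK, hzJ]))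
      rw [hd] at this
      linarith
    -- `W` is harmonic on the whole plane
    set W : OnePoint ℂ → ℝ := fun q =>
      if q ∈ (fun z : ℂ => (z : OnePoint ℂ)) '' J then gK q + r q else gJ q - p q with hW
    have hWJ : ∀ z : ℂ, z ∉ J → W z = gJ z - p z := fun z hz => by simp [hW, hz]
    have hWK : ∀ z : ℂ, z ∉ K → W z = gK z + r z := fun z hz => by
      by_cases hzJ : z ∈ J
      · simp [hW, hzJ]
      · rw [hWJ z hzJ, heq z hz hzJ]
    have hWh : ∀ q, q ∉ ({OnePoint.infty} : Set (OnePoint ℂ)) → HarmonicAtSphere W q := by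
      intro q hq
      induction q using OnePoint.rec with
      | infty => simp at hq
      | coe z =>
        by_cases hzJ : z ∈ J
        · have h1 := (hgK.harmonic z (coe_mem_sphereCompl.2 (hJK z hzJ))
            (OnePoint.coe_ne_infty z)).add (hr.harmonic z (coe_mem_sphereCompl.2 (hJK z hzJ)))
          rw [harmonicAtSphere_coe] at h1 ⊢
          refine (harmonicAt_congr_nhds ?_).1 h1
          filter_upwards [hK.isCompact.isClosed.isOpen_compl.mem_nhds (hJK z hzJ)] with y hy
          exact (hWK y hy).symm
        · have h1 := (hgJ.harmonic z (coe_mem_sphereCompl.2 hzJ)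
            (OnePoint.coe_ne_infty z)).sub (hp.harmonic z (coe_mem_sphereCompl.2 hzJ))
          rw [harmonicAtSphere_coe] at h1 ⊢
          refine (harmonicAt_congr_nhds ?_).1 h1
          filter_upwards [hJr.isCompact.isClosed.isOpen_compl.mem_nhds hzJ] with y hy
          exact (hWJ y hy).symm
    have hWt : Tendsto W (𝓝[≠] OnePoint.infty) atTop := by
      have hpc := (hp.harmonic _ (infty_mem_sphereCompl J)).continuousAt.tendsto.mono_left
        (nhdsWithin_le_nhds (s := {OnePoint.infty}ᶜ))
      refine (hgJ.tendsto_atTop.atTop_add hpc.neg).congr' ?_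
      filter_upwards [nhdsWithin_le_nhds ((isOpen_sphereCompl hJr.isCompact).mem_nhds
        (infty_mem_sphereCompl J))] with q hq
      have hq' : q ∉ (fun z : ℂ => (z : OnePoint ℂ)) '' J := hq
      simp only [hW, if_neg hq', sub_eq_add_neg]
    have hmin : ∀ C : ℝ, C ≤ W (0 : ℂ) := by
      intro C
      have := nonneg_of_boundary_of_isClosed (isClosed_singleton (x := (OnePoint.infty : OnePoint ℂ)))
        (singleton_nonempty _) (u := fun q => W q - C)
        (fun q hq => (hWh q hq).sub (HarmonicAtSphere.const C q)) (by
          rintro x hx ε hε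
          rw [mem_singleton_iff] at hx
          subst hx
          filter_upwards [hWt.eventually_gt_atTop C] with q hq
          linarith) ((0 : ℂ) : OnePoint ℂ) (by simp)
      linarith
    linarith [hmin (W (0 : ℂ) + 1)]
  · refine ⟨fun q => s⁻¹ * (d q - (p q + r q)), ((hdb.sub hpr).const_mul s⁻¹).congr fun x hx => ?_⟩
    simp only [sub_sub_cancel]
    rw [← mul_assoc, inv_mul_cancel₀ hs, one_mul]

open Classical in
lemma IsRegularCompact.union_interval (hK : IsRegularCompact K) (hbc : b < c)
    (hdisj : Disjoint K (interval b c)) : IsRegularCompact (K ∪ interval b c) := by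
  have hJr := isRegularCompact_interval hbc
  obtain ⟨χ, hχ⟩ := exists_harmonicMeasure_union hK hbc hdisj
  have hdir : ∀ f : ℂ → ℝ, ContinuousOn f (K ∪ interval b c) →
      ∃ u, SolvesDirichlet (K ∪ interval b c) f u := by
    intro φ hφ
    obtain ⟨s, f, h, p, r, hp, hr, e1, e2⟩ := exists_dirichlet_union_sub_const hK hbc hdisj
      (hφ.mono subset_union_left) (hφ.mono subset_union_right)
    have hpr : SolvesDirichlet (K ∪ interval b c)
        (fun x => φ x - s * (interval b c).piecewise (fun _ => (1 : ℝ)) (fun _ => 0) x)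
        (fun q => p q + r q) :=
      solvesDirichlet_union_add hdisj hp hr
        (fun x hx => by
          rw [e1 x hx, piecewise_eq_of_notMem _ _ _ (disjoint_left.1 hdisj hx)]; simp)
        (fun x hx => by rw [e2 x hx, piecewise_eq_of_mem _ _ _ hx]; simp)
    exact ⟨_, (hpr.add (hχ.const_mul s)).congr fun x _ => by simp only [sub_add_cancel]⟩
  refine ⟨hK.isCompact.union hJr.isCompact, hK.nonempty.mono subset_union_left, hdir, ?_⟩
  obtain ⟨g, ρ, hg⟩ := hK.green
  have hJK : ∀ x ∈ interval b c, x ∉ K := fun x hx => disjoint_right.1 hdisj hx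
  have hc := continuousOn_piecewise_union hK.isCompact hJr.isCompact hdisj
    (f₁ := fun z : ℂ => g z) (f₂ := fun _ => 0)
    (fun z hz => (hg.continuousAt (hJK z hz)).continuousWithinAt) continuousOn_const
  obtain ⟨u, hu⟩ := hdir _ hc
  refine ⟨fun q => g q - u q, fun w => ρ w - u (chartInfty w), ?_, ?_, ?_, ?_⟩
  · exact fun q hq hqi => (hg.harmonic q (sphereCompl_anti subset_union_left hq) hqi).sub
      (hu.harmonic q hq)
  · intro x hx
    have h2 := hu.boundary x hx
    rcases hx with hx | hx
    · rw [piecewise_eq_of_notMem _ _ _ (disjoint_left.1 hdisj hx)] at h2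
      simpa using ((hg.boundary x hx).mono_left (nhdsWithin_compl_union_le_left x _ _)).sub h2
    · rw [piecewise_eq_of_mem _ _ _ hx] at h2
      simpa using ((hg.continuousAt (hJK x hx)).tendsto.mono_left nhdsWithin_le_nhds).sub h2
  · exact hg.harmonic_part.sub (hu.harmonic _ (infty_mem_sphereCompl _))
  · filter_upwards [hg.chart] with w hw
    rw [hw]; ring

/-- Finite disjoint unions of nondegenerate intervals are regular. -/
theorem isRegularCompact_biUnion_interval {ι : Type*} {b c : ι → ℝ} (hbc : ∀ i, b i < c i)
    (hdisj : ∀ i j, i ≠ j → Disjoint (interval (b i) (c i)) (interval (b j) (c j)))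
    (s : Finset ι) (hs : s.Nonempty) : IsRegularCompact (⋃ i ∈ s, interval (b i) (c i)) := by
  induction hs using Finset.Nonempty.cons_induction with
  | singleton i => simpa using isRegularCompact_interval (hbc i)
  | cons i s hi _ ih =>
    have h := ih.union_interval (hbc i) (by
      rw [disjoint_iUnion₂_left]
      intro j hj
      exact hdisj j i (by rintro rfl; exact hi hj))
    simpa [union_comm] using h

end Union

/-! ### Green's functions with arbitrary pole -/

lemma nhdsNE_coe (z : ℂ) : 𝓝[≠] (z : OnePoint ℂ) = map (fun w : ℂ => (w : OnePoint ℂ)) (𝓝[≠] z) := by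
  ext s
  change (∀ᶠ q in 𝓝[≠] (z : OnePoint ℂ), q ∈ s) ↔ ∀ᶠ w : ℂ in 𝓝[≠] z, (w : OnePoint ℂ) ∈ s
  rw [eventually_nhdsWithin_iff, eventually_nhdsWithin_iff, OnePoint.nhds_coe_eq, eventually_map]
  simp

lemma HasLogPole.tendsto_atTop {g : OnePoint ℂ → ℝ} {p : OnePoint ℂ} (h : HasLogPole g p) :
    Tendsto g (𝓝[≠] p) atTop := by
  induction p using OnePoint.rec with
  | infty =>
    obtain ⟨γ, hγ⟩ := h
    rw [nhdsNE_infty, tendsto_map'_iff]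
    have h1 : Tendsto (fun z : ℂ => Real.log ‖z‖) (Bornology.cobounded ℂ) atTop :=
      Real.tendsto_log_atTop.comp tendsto_norm_cobounded_atTop
    refine (h1.atTop_add hγ).congr fun z => ?_
    simp
  | coe z₀ =>
    obtain ⟨γ, hγ⟩ := h
    rw [nhdsNE_coe, tendsto_map'_iff]
    have h1 : Tendsto (fun z : ℂ => -Real.log ‖z - z₀‖) (𝓝[≠] z₀) atTop :=
      tendsto_neg_atBot_atTop.comp (Real.tendsto_log_nhdsGT_zero.comp (tendsto_norm_sub_self_nhdsNE z₀))
    refine (h1.atTop_add hγ).congr fun z => ?_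
    simp

lemma HasLogPole.tendsto_sub {g g' : OnePoint ℂ → ℝ} {p : OnePoint ℂ} (h : HasLogPole g p)
    (h' : HasLogPole g' p) : ∃ a, Tendsto (fun q => g q - g' q) (𝓝[≠] p) (𝓝 a) := by
  induction p using OnePoint.rec with
  | infty =>
    obtain ⟨γ, hγ⟩ := h
    obtain ⟨γ', hγ'⟩ := h'
    refine ⟨γ - γ', ?_⟩
    rw [nhdsNE_infty, tendsto_map'_iff]
    exact (hγ.sub hγ').congr fun z => by simp
  | coe z₀ =>
    obtain ⟨γ, hγ⟩ := h
    obtain ⟨γ', hγ'⟩ := h'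
    refine ⟨γ - γ', ?_⟩
    rw [nhdsNE_coe, tendsto_map'_iff]
    exact (hγ.sub hγ').congr fun z => by simp

lemma eventually_const_le_of_tendsto {α : Type*} {l : Filter α} {f : α → ℝ} {a : ℝ}
    (h : Tendsto f l (𝓝 a)) : ∃ C, ∀ᶠ x in l, C ≤ f x :=
  ⟨a - 1, h.eventually (le_mem_nhds (by linarith))⟩

namespace IsGreenFunction

variable {K : Set ℂ} {p : OnePoint ℂ} {g g' : OnePoint ℂ → ℝ}

/-- Minimum principle for a function bounded below near the pole of a Green's function. -/
lemma nonneg_of_boundary (hg : IsGreenFunction K p g) (hK : IsCompact K) (hp : p ∈ sphereCompl K)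
    {u : OnePoint ℂ → ℝ} (hu : ∀ q ∈ sphereCompl K, q ≠ p → HarmonicAtSphere u q)
    (hb : ∀ x ∈ K, ∀ ε > 0, ∀ᶠ z : ℂ in 𝓝[Kᶜ] x, -ε < u z)
    (hbdd : ∃ C, ∀ᶠ q in 𝓝[≠] p, C ≤ u q) : ∀ q ∈ sphereCompl K, q ≠ p → 0 ≤ u q :=
  nonneg_of_boundary_of_pole hK hp hu hb hbdd hg.harmonic
    (fun x hx => eventually_neg_lt_of_tendsto (hg.boundary x hx) le_rfl) hg.pole.tendsto_atTop

lemma nonneg (hg : IsGreenFunction K p g) (hK : IsCompact K) (hp : p ∈ sphereCompl K) :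
    ∀ q ∈ sphereCompl K, q ≠ p → 0 ≤ g q :=
  hg.nonneg_of_boundary hK hp hg.harmonic
    (fun x hx => eventually_neg_lt_of_tendsto (hg.boundary x hx) le_rfl)
    ⟨0, hg.pole.tendsto_atTop.eventually_ge_atTop 0⟩

/-- Green's functions increase with the domain. -/
lemma le_of_subset {K' : Set ℂ} (hg : IsGreenFunction K p g) (hg' : IsGreenFunction K' p g')
    (hK : IsCompact K) (hK' : IsCompact K') (hsub : K' ⊆ K) (hp : p ∈ sphereCompl K) :
    ∀ q ∈ sphereCompl K, q ≠ p → g q ≤ g' q := by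
  have hp' := sphereCompl_anti hsub hp
  obtain ⟨a, ha⟩ := hg'.pole.tendsto_sub hg.pole
  intro q hq hqp
  have := hg.nonneg_of_boundary hK hp (u := fun q => g' q - g q)
    (fun q hq hqp => (hg'.harmonic q (sphereCompl_anti hsub hq) hqp).sub (hg.harmonic q hq hqp))
    (fun x hx => ?_) (eventually_const_le_of_tendsto ha) q hq hqp
  · linarith
  · by_cases hx' : x ∈ K'
    · have h1 := ((hg'.boundary x hx').mono_left
        (nhdsWithin_mono _ (compl_subset_compl.2 hsub))).sub (hg.boundary x hx)
      exact eventually_neg_lt_of_tendsto h1 (by simp)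
    · have hxp : (x : OnePoint ℂ) ≠ p := by
        rintro rfl
        exact coe_mem_sphereCompl.1 hp hx
      have hxs := coe_mem_sphereCompl.2 hx'
      have hc : Tendsto (fun z : ℂ => g' z) (𝓝[Kᶜ] x) (𝓝 (g' x)) :=
        ((hg'.harmonic x hxs hxp).1.continuousAt.tendsto).mono_left nhdsWithin_le_nhds
      refine eventually_neg_lt_of_tendsto (hc.sub (hg.boundary x hx)) ?_
      simpa using hg'.nonneg hK' hp' x hxs hxp

lemma unique (hg : IsGreenFunction K p g) (hg' : IsGreenFunction K p g') (hK : IsCompact K)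
    (hp : p ∈ sphereCompl K) : ∀ q ∈ sphereCompl K, q ≠ p → g q = g' q := fun q hq hqp =>
  le_antisymm (hg.le_of_subset hg' hK hK subset_rfl hp q hq hqp)
    (hg'.le_of_subset hg hK hK subset_rfl hp q hq hqp)

end IsGreenFunction

lemma continuousOn_log_norm_sub {K : Set ℂ} {c : ℂ} (hc : c ∉ K) :
    ContinuousOn (fun t : ℂ => Real.log ‖t - c‖) K := by
  refine ContinuousOn.log (by fun_prop) fun t ht => ?_
  rw [norm_ne_zero_iff, sub_ne_zero]
  rintro rfl
  exact hc ht

/-- The Green's function with finite pole `c` is `g - log ‖z - c‖ + u`, where `g` is the Green's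
function with pole at `∞` and `u` has boundary values `log ‖z - c‖`. -/
lemma exists_isGreenFunction_coe {K : Set ℂ} {g : OnePoint ℂ → ℝ} {ρ : ℂ → ℝ}
    (hg : IsGreenAtInfty K g ρ) {c : ℂ} (hc : c ∉ K) {u : OnePoint ℂ → ℝ}
    (hu : SolvesDirichlet K (fun t => Real.log ‖t - c‖) u) :
    ∃ G, IsGreenFunction K c G ∧ G OnePoint.infty = ρ 0 + u OnePoint.infty := by
  have hA : AnalyticAt ℂ (fun w : ℂ => 1 - c * w) 0 := by fun_prop
  have hr : HarmonicAt (fun w => ρ w - Real.log ‖1 - c * w‖ + u (chartInfty w)) 0 :=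
    (hg.harmonic_part.sub (hA.harmonicAt_log_norm (by simp))).add
      (hu.harmonic _ (infty_mem_sphereCompl K))
  set v : OnePoint ℂ → ℝ := fun q => g q - Option.elim q 0 (fun z : ℂ => Real.log ‖z - c‖) + u q
    with hv
  have hvz : ∀ z : ℂ, v z = g z - Real.log ‖z - c‖ + u z := fun z => rfl
  obtain ⟨G, hG, hGi, hGh⟩ := exists_harmonic_extension_infty (u := v) hr (by
    have hne : ∀ᶠ w : ℂ in 𝓝[≠] 0, 1 - c * w ≠ 0 :=
      (hA.continuousAt.eventually_ne (by simp)).filter_mono nhdsWithin_le_nhds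
    filter_upwards [hg.chart, self_mem_nhdsWithin, hne] with w hw hw0 h1
    have hw0' : w ≠ 0 := hw0
    have e1 : v (chartInfty w) = g (chartInfty w) - Real.log ‖w⁻¹ - c‖ + u (chartInfty w) := by
      rw [chartInfty_of_ne hw0']; rfl
    have e2 : w⁻¹ - c = (1 - c * w) / w := by field_simp
    rw [e1, hw, e2, norm_div, Real.log_div (norm_ne_zero_iff.2 h1) (norm_ne_zero_iff.2 hw0')]
    ring)
  refine ⟨G, ⟨?_, ?_, ?_⟩, ?_⟩
  · intro q hq hqc
    induction q using OnePoint.rec with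
    | infty => exact hGh
    | coe z =>
      rw [harmonicAtSphere_coe]
      simp only [hG, hvz]
      have hzc : z - c ≠ 0 := sub_ne_zero.2 (by rintro rfl; exact hqc rfl)
      exact ((hg.harmonic z hq (OnePoint.coe_ne_infty z)).sub
        (show HarmonicAtSphere (fun q => Option.elim q 0 fun z : ℂ => Real.log ‖z - c‖) z from
          AnalyticAt.harmonicAt_log_norm (f := fun z => z - c) (by fun_prop) hzc)).add
        (hu.harmonic z hq)
  · refine ⟨g c + u c, ?_⟩
    have h1 : Tendsto (fun z : ℂ => g z + u z) (𝓝[≠] c) (𝓝 (g c + u c)) :=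
      ((hg.continuousAt hc).add (hu.continuousAt hc)).tendsto.mono_left nhdsWithin_le_nhds
    refine h1.congr fun z => ?_
    rw [hG, hvz]; ring
  · intro x hx
    have hlog : Tendsto (fun t : ℂ => Real.log ‖t - c‖) (𝓝[Kᶜ] x) (𝓝 (Real.log ‖x - c‖)) := by
      refine Tendsto.mono_left ?_ nhdsWithin_le_nhds
      have hxc : ‖x - c‖ ≠ 0 := by
        rw [norm_ne_zero_iff, sub_ne_zero]; rintro rfl; exact hc hx
      exact ContinuousAt.log (f := fun t : ℂ => ‖t - c‖) (by fun_prop) hxc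
    have h1 := ((hg.boundary x hx).sub hlog).add (hu.boundary x hx)
    simp only [zero_sub, neg_add_cancel] at h1
    exact h1.congr fun z => by rw [hG, hvz]
  · rw [hGi, chartInfty_zero]; simp

/-! ### Symmetry of the Green's function -/

lemma log_norm_one_sub_taylor {x : ℂ} (hx : ‖x‖ < 1) (n : ℕ) :
    |Real.log ‖1 - x‖ + (∑ k ∈ Finset.range (n + 1), x ^ k / k).re| ≤
      ‖x‖ ^ (n + 1) * (1 - ‖x‖)⁻¹ := by
  have h := Complex.norm_log_sub_logTaylor_le n (z := -x) (by simpa using hx)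
  have e : Complex.logTaylor (n + 1) (-x) = -∑ k ∈ Finset.range (n + 1), x ^ k / k := by
    rw [Complex.logTaylor, ← Finset.sum_neg_distrib]
    refine Finset.sum_congr rfl fun k _ => ?_
    rw [neg_pow x k, ← mul_assoc, ← pow_add, show k + 1 + k = 2 * k + 1 by ring]
    simp [pow_add, neg_div]
  rw [e, norm_neg, sub_neg_eq_add, ← sub_eq_add_neg] at h
  have h2 := (Complex.abs_re_le_norm _).trans h
  rw [Complex.add_re, Complex.log_re] at h2
  refine h2.trans (div_le_self ?_ ?_)
  · have : 0 ≤ (1 - ‖x‖)⁻¹ := inv_nonneg.2 (by linarith)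
    positivity
  · linarith [Nat.cast_nonneg (α := ℝ) n]

/-- The value at `∞` of the solution with boundary data `log ‖t - c‖` is harmonic in `c`: by
linearity and the maximum principle, the expansion of the data in powers of `c - c₀` carries over to
the solutions. -/
lemma harmonicAt_solution_log {K : Set ℂ} (hK : IsRegularCompact K) {U : ℂ → OnePoint ℂ → ℝ}
    (hU : ∀ c ∉ K, SolvesDirichlet K (fun t => Real.log ‖t - c‖) (U c)) {c₀ : ℂ} (hc₀ : c₀ ∉ K) :
    HarmonicAt (fun c => U c OnePoint.infty) c₀ := by
  obtain ⟨d, hd, hball⟩ := Metric.isOpen_iff.1 hK.isCompact.isClosed.isOpen_compl c₀ hc₀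
  have hdist : ∀ t ∈ K, d ≤ ‖t - c₀‖ := by
    intro t ht
    by_contra! hlt
    exact hball (mem_ball_iff_norm.2 hlt) ht
  have hne : ∀ t ∈ K, t - c₀ ≠ 0 := fun t ht h => by
    have := hdist t ht
    rw [h, norm_zero] at this
    linarith
  have hpc : ∀ k : ℕ, ContinuousOn (fun t : ℂ => ((t - c₀)⁻¹) ^ k) K := fun k =>
    (ContinuousOn.inv₀ (by fun_prop) hne).pow k
  choose A hA using fun k : ℕ => hK.dirichlet (fun t => (((t - c₀)⁻¹) ^ k).re)
    (Complex.continuous_re.comp_continuousOn (hpc k))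
  choose B hB using fun k : ℕ => hK.dirichlet (fun t => (((t - c₀)⁻¹) ^ k).im)
    (Complex.continuous_im.comp_continuousOn (hpc k))
  have hpn : ∀ (k : ℕ), ∀ t ∈ K, ‖((t - c₀)⁻¹) ^ k‖ ≤ (d⁻¹) ^ k := by
    intro k t ht
    rw [norm_pow, norm_inv]
    have := hdist t ht
    gcongr
  set l : ℕ → ℂ := fun k => ⟨A k OnePoint.infty, B k OnePoint.infty⟩ with hl
  have hinf := infty_mem_sphereCompl K
  have hln : ∀ k, ‖l k‖ ≤ 2 * (d⁻¹) ^ k := by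
    intro k
    have h1 := (hA k).abs_le hK.isCompact hK.nonempty
      (fun t ht => (Complex.abs_re_le_norm _).trans (hpn k t ht)) _ hinf
    have h2 := (hB k).abs_le hK.isCompact hK.nonempty
      (fun t ht => (Complex.abs_im_le_norm _).trans (hpn k t ht)) _ hinf
    refine (Complex.norm_le_abs_re_add_abs_im _).trans ?_
    simp only [hl]
    linarith
  set F : ℂ → ℂ := fun c => ∑' k : ℕ, (c - c₀) ^ k / k * l k with hF
  have hterm : ∀ (k : ℕ), ∀ c ∈ ball c₀ (d / 2), ‖(c - c₀) ^ k / k * l k‖ ≤ 2 * (1 / 2) ^ k := by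
    intro k c hc
    rw [mem_ball_iff_norm] at hc
    have h1 : ‖(c - c₀) ^ k / k‖ ≤ (d / 2) ^ k := by
      rw [norm_div, norm_pow, RCLike.norm_natCast]
      rcases Nat.eq_zero_or_pos k with rfl | hk
      · simp
      · refine (div_le_self (by positivity) (by exact_mod_cast hk)).trans ?_
        gcongr
    rw [norm_mul]
    calc ‖(c - c₀) ^ k / k‖ * ‖l k‖ ≤ (d / 2) ^ k * (2 * (d⁻¹) ^ k) := by
          gcongr
          exact hln k
      _ = 2 * (d / 2 * d⁻¹) ^ k := by rw [mul_pow]; ring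
      _ = 2 * (1 / 2) ^ k := by congr 2; field_simp
  have hsum : Summable fun k : ℕ => 2 * (1 / 2 : ℝ) ^ k :=
    (summable_geometric_of_lt_one (by norm_num) (by norm_num)).mul_left 2
  have hFd : DifferentiableOn ℂ F (ball c₀ (d / 2)) :=
    Complex.differentiableOn_tsum_of_summable_norm hsum (fun k => by fun_prop) isOpen_ball hterm
  have hFa : AnalyticAt ℂ F c₀ := hFd.analyticAt (ball_mem_nhds c₀ (by positivity))
  have hmain : ∀ c ∈ ball c₀ (d / 2), U c OnePoint.infty = U c₀ OnePoint.infty - (F c).re := by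
    intro c hc
    have hcK : c ∉ K := fun h => hball (ball_subset_ball (by linarith) hc) h
    have hsol : ∀ n : ℕ, SolvesDirichlet K
        (fun t => Real.log ‖t - c₀‖ - (∑ k ∈ Finset.range n,
          (c - c₀) ^ k / k * ((t - c₀)⁻¹) ^ k).re)
        (fun q => U c₀ q - (∑ k ∈ Finset.range n, (c - c₀) ^ k / k * (⟨A k q, B k q⟩ : ℂ)).re) := by
      intro n
      refine (hU c₀ hc₀).sub ?_
      induction n with
      | zero => simpa using SolvesDirichlet.const K 0
      | succ n ih =>
        simp only [Finset.sum_range_succ, Complex.add_re, Complex.mul_re]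
        exact ih.add (((hA n).const_mul _).sub ((hB n).const_mul _))
    have hdiff : ∀ n : ℕ, |U c OnePoint.infty - (U c₀ OnePoint.infty -
        (∑ k ∈ Finset.range (n + 1), (c - c₀) ^ k / k * l k).re)| ≤ (1 / 2 : ℝ) ^ (n + 1) * 2 := by
      intro n
      refine ((hU c hcK).sub (hsol (n + 1))).abs_le hK.isCompact hK.nonempty (fun t ht => ?_) _ hinf
      have ht0 := hne t ht
      set x : ℂ := (c - c₀) * (t - c₀)⁻¹ with hx
      have hxn : ‖x‖ ≤ 1 / 2 := by
        rw [hx, norm_mul, norm_inv]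
        rw [mem_ball_iff_norm] at hc
        calc ‖c - c₀‖ * ‖t - c₀‖⁻¹ ≤ d / 2 * d⁻¹ := by
              have := hdist t ht
              gcongr
          _ = 1 / 2 := by field_simp
      have htc : t - c = (t - c₀) * (1 - x) := by rw [hx]; field_simp; ring
      have h1x : 1 - x ≠ 0 := by
        intro h
        rw [h, mul_zero, sub_eq_zero] at htc
        exact hcK (htc ▸ ht)
      have hT := log_norm_one_sub_taylor (show ‖x‖ < 1 by linarith) n
      have e1 : ∀ k : ℕ, (c - c₀) ^ k / k * ((t - c₀)⁻¹) ^ k = x ^ k / k := by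
        intro k
        rw [hx, mul_pow]; ring
      simp only [e1]
      rw [htc, norm_mul, Real.log_mul (norm_ne_zero_iff.2 ht0) (norm_ne_zero_iff.2 h1x)]
      have h2 : ‖x‖ ^ (n + 1) * (1 - ‖x‖)⁻¹ ≤ (1 / 2 : ℝ) ^ (n + 1) * 2 := by
        have : (1 - ‖x‖)⁻¹ ≤ 2 := by
          rw [inv_le_comm₀ (by linarith) (by norm_num)]
          linarith
        have : 0 ≤ (1 - ‖x‖)⁻¹ := inv_nonneg.2 (by linarith)
        gcongr
      refine le_trans (le_of_eq ?_) (hT.trans h2)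
      congr 1
      ring
    have hS : Summable fun k : ℕ => (c - c₀) ^ k / k * l k :=
      Summable.of_norm_bounded hsum fun k => hterm k c hc
    have hlim : Tendsto (fun n : ℕ => U c OnePoint.infty - (U c₀ OnePoint.infty -
        (∑ k ∈ Finset.range (n + 1), (c - c₀) ^ k / k * l k).re)) atTop
        (𝓝 (U c OnePoint.infty - (U c₀ OnePoint.infty - (F c).re))) := by
      have := (hS.hasSum.tendsto_sum_nat.comp (tendsto_add_atTop_nat 1))
      exact (((Complex.continuous_re.tendsto _).comp this).const_sub _).const_sub _
    have hzero : Tendsto (fun n : ℕ => (1 / 2 : ℝ) ^ (n + 1) * 2) atTop (𝓝 0) := by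
      have h0 := tendsto_pow_atTop_nhds_zero_of_lt_one (r := (1 / 2 : ℝ)) (by norm_num) (by norm_num)
      simpa using (h0.comp (tendsto_add_atTop_nat 1)).mul_const 2
    have := tendsto_nhds_unique hlim (squeeze_zero_norm hdiff hzero)
    linarith
  refine (harmonicAt_congr_nhds ?_).1
    ((harmonicAt_const (U c₀ OnePoint.infty)).sub hFa.harmonicAt_re)
  filter_upwards [ball_mem_nhds c₀ (show 0 < d / 2 by positivity)] with c hc
  exact (hmain c hc).symm

/-- **Symmetry** of the Green's function when one of the two points is `∞`. As a function of the pole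
`c`, the value `G_c(∞)` is harmonic off `K`, has a logarithmic pole at `∞`, and tends to `0` on `K`,
because it is at most the corresponding value for a single interval contained in `K`. Hence it is the
Green's function with pole at `∞`. -/
theorem exists_isGreenFunction_infty_eq {K : Set ℂ} (hK : IsRegularCompact K)
    (hcov : ∀ x ∈ K, ∃ b c : ℝ, b < c ∧ x ∈ interval b c ∧ interval b c ⊆ K)
    {g : OnePoint ℂ → ℝ} {ρ : ℂ → ℝ} (hg : IsGreenAtInfty K g ρ) {c : ℂ} (hc : c ∉ K) :
    ∃ G, IsGreenFunction K c G ∧ G OnePoint.infty = g c := by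
  have hUex : ∀ c : ℂ, c ∉ K → ∃ u, SolvesDirichlet K (fun t => Real.log ‖t - c‖) u :=
    fun c hc => hK.dirichlet _ (continuousOn_log_norm_sub hc)
  choose! U hU using hUex
  have hGex : ∀ c : ℂ, c ∉ K → ∃ G, IsGreenFunction K c G ∧
      G OnePoint.infty = ρ 0 + U c OnePoint.infty :=
    fun c hc => exists_isGreenFunction_coe hg hc (hU c hc)
  set h : ℂ → ℝ := fun c => ρ 0 + U c OnePoint.infty with hh
  have hinf := infty_mem_sphereCompl K
  have h0 : ∀ c ∉ K, 0 ≤ h c := by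
    intro c hc
    obtain ⟨G, hG, hGi⟩ := hGex c hc
    change 0 ≤ ρ 0 + U c OnePoint.infty
    rw [← hGi]
    exact hG.nonneg hK.isCompact (coe_mem_sphereCompl.2 hc) _ hinf (OnePoint.infty_ne_coe c)
  have hharm : ∀ q ∈ sphereCompl K, q ≠ OnePoint.infty →
      HarmonicAtSphere (fun q => Option.elim q 0 h) q := by
    intro q hq hqi
    induction q using OnePoint.rec with
    | infty => exact absurd rfl hqi
    | coe z =>
      rw [harmonicAtSphere_coe]
      exact (harmonicAt_const (ρ 0)).add
        (harmonicAt_solution_log hK hU (coe_mem_sphereCompl.1 hq))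
  have hbdry : ∀ x ∈ K, Tendsto h (𝓝[Kᶜ] x) (𝓝 0) := by
    intro x hx
    obtain ⟨b, e, hbe, hxJ, hJK⟩ := hcov x hx
    have hlog : Tendsto (fun z : ℂ => -Real.log ‖discMap b e z‖) (𝓝[Kᶜ] x) (𝓝 0) := by
      have := ((Real.continuousAt_log one_ne_zero).tendsto.comp
        ((tendsto_norm_discMap_of_mem hbe hxJ).mono_left
          (nhdsWithin_mono _ (compl_subset_compl.2 hJK)))).neg
      simpa using this
    refine squeeze_zero' ?_ ?_ hlog
    · filter_upwards [self_mem_nhdsWithin] with c hc using h0 c hc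
    · filter_upwards [self_mem_nhdsWithin] with c hc
      obtain ⟨G, hG, hGi⟩ := hGex c hc
      obtain ⟨G', hG', hGi'⟩ := exists_isGreenFunction_interval hbe (fun hcJ => hc (hJK hcJ))
      change ρ 0 + U c OnePoint.infty ≤ _
      rw [← hGi', ← hGi]
      exact hG.le_of_subset hG' hK.isCompact (isCompact_interval b e) hJK
        (coe_mem_sphereCompl.2 hc) _ hinf (OnePoint.infty_ne_coe c)
  obtain ⟨C, hC⟩ : ∃ C, ∀ᶠ c : ℂ in Bornology.cobounded ℂ, |h c - g c| ≤ C := by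
    obtain ⟨M, hM⟩ := hK.isCompact.isBounded.exists_norm_le
    have h1 : ∀ᶠ c : ℂ in Bornology.cobounded ℂ, |g c - Real.log ‖c‖ - ρ 0| ≤ 1 := by
      have := hg.tendsto_sub_log.eventually (ball_mem_nhds _ one_pos)
      filter_upwards [this] with c hc
      rw [Real.dist_eq] at hc
      exact hc.le
    refine ⟨Real.log 2 + 1, ?_⟩
    filter_upwards [h1, tendsto_norm_cobounded_atTop.eventually_gt_atTop (2 * |M|),
      (Bornology.isBounded_def.1 hK.isCompact.isBounded)] with c hc1 hc2 hcK
    have hM0 := le_abs_self M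
    have hc0 : 0 < ‖c‖ := lt_of_le_of_lt (by positivity) hc2
    have h2 : |U c OnePoint.infty - Real.log ‖c‖| ≤ Real.log 2 := by
      refine ((hU c hcK).sub (SolvesDirichlet.const K (Real.log ‖c‖))).abs_le hK.isCompact
        hK.nonempty (fun t ht => ?_) _ hinf
      have htM := hM t ht
      have l1 : ‖c‖ / 2 ≤ ‖t - c‖ := by
        have := norm_sub_norm_le c t
        rw [norm_sub_rev] at this
        linarith
      have l2 : ‖t - c‖ ≤ ‖c‖ * 2 := by
        have := norm_sub_le t c
        linarith
      have l1' := Real.log_le_log (by positivity) l1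
      have l2' := Real.log_le_log (by linarith) l2
      rw [Real.log_div hc0.ne' two_ne_zero] at l1'
      rw [Real.log_mul hc0.ne' two_ne_zero] at l2'
      rw [abs_le]
      constructor <;> linarith
    have e : h c - g c = (U c OnePoint.infty - Real.log ‖c‖) -
        (g c - Real.log ‖c‖ - ρ 0) := by simp only [hh]; ring
    rw [e]
    exact (abs_sub _ _).trans (by linarith)
  have hle1 := hg.nonneg_of_boundary hK.isCompact (u := fun q => g q - Option.elim q 0 h)
    (fun q hq hqi => (hg.harmonic q hq hqi).sub (hharm q hq hqi))
    (fun x hx => eventually_neg_lt_of_tendsto ((hg.boundary x hx).sub (hbdry x hx)) (by simp))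
    ⟨-C, by
      rw [nhdsNE_infty, eventually_map]
      filter_upwards [hC] with z hz
      change -C ≤ g z - h z
      linarith [(abs_le.1 hz).2]⟩ c hc
  have hle2 := hg.nonneg_of_boundary hK.isCompact (u := fun q => Option.elim q 0 h - g q)
    (fun q hq hqi => (hharm q hq hqi).sub (hg.harmonic q hq hqi))
    (fun x hx => eventually_neg_lt_of_tendsto ((hbdry x hx).sub (hg.boundary x hx)) (by simp))
    ⟨-C, by
      rw [nhdsNE_infty, eventually_map]
      filter_upwards [hC] with z hz
      change -C ≤ h z - g z
      linarith [(abs_le.1 hz).1]⟩ c hc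
  change 0 ≤ g c - h c at hle1
  change 0 ≤ h c - g c at hle2
  obtain ⟨G, hG, hGi⟩ := hGex c hc
  exact ⟨G, hG, by rw [hGi]; change h c = g c; linarith⟩

/-! ### Harmonic measures and capacities of finite unions of intervals -/

lemma isHarmonicMeasure_of_solvesDirichlet {K K' : Set ℂ} {u : OnePoint ℂ → ℝ} (hsub : K' ⊆ K)
    (hu : SolvesDirichlet K (K'.indicator fun _ => 1) u) : IsHarmonicMeasure K' K u :=
  ⟨hu.harmonic, fun x hx => by simpa [hx] using hu.boundary x (hsub hx),
    fun x hx => by simpa [hx.2] using hu.boundary x hx.1⟩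

lemma isHarmonicMeasure_harmonicMeasure {K K' : Set ℂ} (h : ∃ u, IsHarmonicMeasure K' K u) :
    IsHarmonicMeasure K' K (fun q => harmonicMeasure q K' K) := by
  have e : (fun q => harmonicMeasure q K' K) = h.choose := by
    funext q
    simp [harmonicMeasure, h]
  rw [e]
  exact h.choose_spec

lemma isGreenFunction_greenFunction {K : Set ℂ} {p : OnePoint ℂ}
    (h : ∃ g, IsGreenFunction K p g) : IsGreenFunction K p (greenFunction K p) := by
  have e : greenFunction K p = h.choose := by simp [greenFunction, h]
  rw [e]
  exact h.choose_spec

lemma capacity_eq {K : Set ℂ} {γ : ℝ}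
    (h : Tendsto (fun z : ℂ => greenFunction K OnePoint.infty z - Real.log ‖z‖)
      (Bornology.cobounded ℂ) (𝓝 γ)) : capacity K = Real.exp (-γ) := by
  refine Tendsto.limUnder_eq (((Real.continuous_exp.tendsto _).comp h.neg).congr' ?_)
  filter_upwards [Bornology.eventually_ne_cobounded (0 : ℂ)] with z hz
  simp only [Function.comp_apply, neg_sub, absPhi, Real.exp_sub]
  rw [Real.exp_log (norm_pos_iff.2 hz)]

section Family

variable {ι : Type*} [Fintype ι] {b c : ι → ℝ}

lemma isRegularCompact_iUnion_interval [Nonempty ι] (hbc : ∀ i, b i < c i)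
    (hdisj : ∀ i j, i ≠ j → Disjoint (interval (b i) (c i)) (interval (b j) (c j))) :
    IsRegularCompact (⋃ i, interval (b i) (c i)) := by
  simpa using isRegularCompact_biUnion_interval hbc hdisj Finset.univ Finset.univ_nonempty

open Classical in
lemma isHarmonicMeasure_interval (hbc : ∀ i, b i < c i)
    (hdisj : ∀ i j, i ≠ j → Disjoint (interval (b i) (c i)) (interval (b j) (c j))) (i : ι) :
    IsHarmonicMeasure (interval (b i) (c i)) (⋃ i, interval (b i) (c i))
      (fun q => harmonicMeasure q (interval (b i) (c i)) (⋃ i, interval (b i) (c i))) := by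
  have : Nonempty ι := ⟨i⟩
  have hsub : interval (b i) (c i) ⊆ ⋃ i, interval (b i) (c i) :=
    subset_iUnion (fun i => interval (b i) (c i)) i
  have hrest : IsCompact (⋃ j ∈ ({i}ᶜ : Set ι), interval (b j) (c j)) :=
    (toFinite _).isCompact_biUnion fun j _ => isCompact_interval _ _
  have hd : Disjoint (⋃ j ∈ ({i}ᶜ : Set ι), interval (b j) (c j)) (interval (b i) (c i)) := by
    rw [disjoint_iUnion₂_left]
    exact fun j hj => hdisj j i hj
  have hun : (⋃ j ∈ ({i}ᶜ : Set ι), interval (b j) (c j)) ∪ interval (b i) (c i) =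
      ⋃ i, interval (b i) (c i) := by
    rw [union_comm, ← biUnion_insert i _ fun j => interval (b j) (c j), insert_eq, union_compl_self, biUnion_univ]
  have hc := continuousOn_piecewise_union hrest (isCompact_interval _ _) hd
    (continuousOn_const (c := (1 : ℝ))) (continuousOn_const (c := (0 : ℝ)))
  rw [hun] at hc
  obtain ⟨u, hu⟩ := (isRegularCompact_iUnion_interval hbc hdisj).dirichlet _ hc
  refine isHarmonicMeasure_harmonicMeasure ⟨u, isHarmonicMeasure_of_solvesDirichlet hsub
    (hu.congr fun x _ => ?_)⟩
  by_cases hx : x ∈ interval (b i) (c i) <;> simp [hx]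

end Family

/-! ### Lower bound for the harmonic measure of an interval -/

lemma le_circleAverage_bump {R μ r : ℝ} (hr : 0 < r) (h1 : -R ≤ μ - r) (h2 : μ + r ≤ R) :
    r / (8 * Real.pi * R) ≤
      Real.circleAverage (fun ζ : ℂ => max 0 (1 - ((R * ζ.re - μ) / r) ^ 2)) 0 1 := by
  have hR : 0 < R := by linarith
  have hrR : r ≤ R := by linarith
  have hpi := Real.pi_gt_three
  set F : ℝ → ℝ := fun θ => max 0 (1 - ((R * Real.cos θ - μ) / r) ^ 2) with hF
  have hFc : Continuous F := by fun_prop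
  have hav : Real.circleAverage (fun ζ : ℂ => max 0 (1 - ((R * ζ.re - μ) / r) ^ 2)) 0 1 =
      (2 * Real.pi)⁻¹ * ∫ θ in (0 : ℝ)..2 * Real.pi, F θ := by
    rw [Real.circleAverage_def, smul_eq_mul]
    simp [hF, circleMap, Complex.exp_ofReal_mul_I_re]
  set θ₀ := Real.arccos (μ / R) with hθ₀
  have hcos : R * Real.cos θ₀ = μ := by
    rw [hθ₀, Real.cos_arccos]
    · field_simp
    · rw [le_div_iff₀ hR]; linarith
    · rw [div_le_iff₀ hR]; linarith
  have hθ0 : 0 ≤ θ₀ := Real.arccos_nonneg _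
  have hθπ : θ₀ ≤ Real.pi := Real.arccos_le_pi _
  set δ := r / (2 * R) with hδ
  have hδ0 : 0 < δ := by positivity
  have hδ1 : δ ≤ 1 / 2 := by
    rw [hδ, div_le_iff₀ (by positivity)]; linarith
  have hlow : ∀ θ ∈ Icc θ₀ (θ₀ + δ), 1 / 2 ≤ F θ := by
    intro θ hθ
    have a1 : |R * Real.cos θ - μ| ≤ r / 2 := by
      rw [← hcos, ← mul_sub, abs_mul, abs_of_pos hR]
      calc R * |Real.cos θ - Real.cos θ₀| ≤ R * |θ - θ₀| :=
            mul_le_mul_of_nonneg_left (Real.abs_cos_sub_cos_le _ _) hR.le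
        _ ≤ R * δ := by
            rw [abs_of_nonneg (by linarith [hθ.1])]
            gcongr
            linarith [hθ.2]
        _ = r / 2 := by rw [hδ]; field_simp
    have a2 : ((R * Real.cos θ - μ) / r) ^ 2 ≤ (1 / 2) ^ 2 := by
      rw [← sq_abs, abs_div, abs_of_pos hr]
      refine pow_le_pow_left₀ (by positivity) ?_ 2
      rw [div_le_iff₀ hr]
      linarith
    refine le_max_of_le_right ?_
    linarith
  have hint : δ * (1 / 2) ≤ ∫ θ in (0 : ℝ)..2 * Real.pi, F θ := by
    calc δ * (1 / 2) = ∫ _ in θ₀..(θ₀ + δ), (1 / 2 : ℝ) := by simp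
      _ ≤ ∫ θ in θ₀..(θ₀ + δ), F θ :=
          intervalIntegral.integral_mono_on (by linarith) (by simp)
            (hFc.intervalIntegrable _ _) hlow
      _ ≤ ∫ θ in (0 : ℝ)..2 * Real.pi, F θ :=
          intervalIntegral.integral_mono_interval hθ0 (by linarith) (by linarith)
            (Eventually.of_forall fun θ => le_max_left _ _) (hFc.intervalIntegrable _ _)
  rw [hav]
  calc r / (8 * Real.pi * R) = (2 * Real.pi)⁻¹ * (δ * (1 / 2)) := by
        rw [hδ]; field_simp; ring
    _ ≤ _ := by gcongr

/-- The harmonic measure at `∞` of an interval is at least proportional to its length. It is compared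
with the Poisson integral of a bump function in the larger set `[-R, R]`. -/
lemma le_harmonicMeasure_interval {K : Set ℂ} (hK : IsCompact K) {b c R : ℝ} (hbc : b < c)
    (hsub : interval b c ⊆ K) (hKR : K ⊆ interval (-R) R) {w : OnePoint ℂ → ℝ}
    (hw : IsHarmonicMeasure (interval b c) K w) :
    (c - b) / (16 * Real.pi * R) ≤ w OnePoint.infty := by
  have hbR := (ofReal_mem_interval.1 (hKR (hsub (ofReal_mem_interval.2 ⟨le_rfl, hbc.le⟩)))).1
  have hcR := (ofReal_mem_interval.1 (hKR (hsub (ofReal_mem_interval.2 ⟨hbc.le, le_rfl⟩)))).2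
  have hR : -R < R := by linarith
  set μ := (b + c) / 2 with hμ
  set r := (c - b) / 2 with hr
  have hr0 : 0 < r := by rw [hr]; linarith
  set f : ℂ → ℝ := fun x => max 0 (1 - ((x.re - μ) / r) ^ 2) with hf
  have hfc : Continuous f := by fun_prop
  have hs := solvesDirichlet_interval hR hfc.continuousOn
  have hf1 : ∀ x, f x ≤ 1 := fun x => max_le zero_le_one (by
    have := sq_nonneg ((x.re - μ) / r)
    linarith)
  have hne : K.Nonempty := ⟨b, hsub (ofReal_mem_interval.2 ⟨le_rfl, hbc.le⟩)⟩
  have hw0 : ∀ q ∈ sphereCompl K, 0 ≤ w q := by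
    refine nonneg_of_boundary hK hne hw.harmonic fun x hx => ?_
    by_cases hxJ : x ∈ interval b c
    · exact eventually_neg_lt_of_tendsto (hw.boundary_one x hxJ) zero_le_one
    · exact eventually_neg_lt_of_tendsto (hw.boundary_zero x ⟨hx, hxJ⟩) le_rfl
  have hf0 : ∀ x ∈ interval (-R) R, x ∉ interval b c → f x = 0 := by
    intro x hx hxJ
    refine max_eq_left ?_
    have hor : x.re < b ∨ c < x.re := by
      by_contra! hcon
      exact hxJ (mem_interval.2 ⟨(mem_interval.1 hx).1, hcon.1, hcon.2⟩)
    have : 1 ≤ ((x.re - μ) / r) ^ 2 := by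
      rw [div_pow, le_div_iff₀ (by positivity)]
      rcases hor with h | h <;> nlinarith
    linarith
  have hle := nonneg_of_boundary (isCompact_interval (-R) R)
    ⟨b, hKR (hsub (ofReal_mem_interval.2 ⟨le_rfl, hbc.le⟩))⟩
    (u := fun q => w q - poissonIntegral (fun ζ => f (arcPoint (-R) R ζ)) (discMap (-R) R q))
    (fun q hq => (hw.harmonic q (sphereCompl_anti hKR hq)).sub (hs.harmonic q hq))
    (fun x hx => ?_) _ (infty_mem_sphereCompl _)
  · rw [discMap_infty, poissonIntegral_zero] at hle
    have h1 := le_circleAverage_bump (R := R) (μ := μ) hr0 (by rw [hμ, hr]; linarith)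
      (by rw [hμ, hr]; linarith)
    have e : (fun ζ : ℂ => f (arcPoint (-R) R ζ)) =
        fun ζ : ℂ => max 0 (1 - ((R * ζ.re - μ) / r) ^ 2) := by
      funext ζ
      have : (arcPoint (-R) R ζ).re = R * ζ.re := by
        rw [arcPoint, Complex.ofReal_re]; ring
      simp only [hf, this]
    rw [e] at hle
    have e2 : (c - b) / (16 * Real.pi * R) = r / (8 * Real.pi * R) := by
      rw [hr]; field_simp; ring
    rw [e2]
    linarith
  · have hmono : 𝓝[(interval (-R) R)ᶜ] x ≤ 𝓝[Kᶜ] x :=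
      nhdsWithin_mono _ (compl_subset_compl.2 hKR)
    by_cases hxJ : x ∈ interval b c
    · exact eventually_neg_lt_of_tendsto
        (((hw.boundary_one x hxJ).mono_left hmono).sub (hs.boundary x hx)) (by linarith [hf1 x])
    · have hfx := hs.boundary x hx
      rw [hf0 x hx hxJ] at hfx
      by_cases hxK : x ∈ K
      · exact eventually_neg_lt_of_tendsto
          (((hw.boundary_zero x ⟨hxK, hxJ⟩).mono_left hmono).sub hfx) (by simp)
      · have hxs := coe_mem_sphereCompl.2 hxK
        have hc : Tendsto (fun z : ℂ => w z) (𝓝[(interval (-R) R)ᶜ] x) (𝓝 (w x)) :=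
          ((hw.harmonic x hxs).1.continuousAt.tendsto).mono_left nhdsWithin_le_nhds
        exact eventually_neg_lt_of_tendsto (hc.sub hfx) (by simpa using hw0 x hxs)

/-! ### Comparison with the harmonic measures of the small intervals -/

section Comparison

variable {ι : Type*} [Fintype ι] {E : Set ℂ} {J : ι → Set ℂ} {w : ι → OnePoint ℂ → ℝ}
  {d g : OnePoint ℂ → ℝ} {D : ℝ}

/-- A function harmonic off `E ∪ ⋃ k, J k`, except perhaps at `∞`, with boundary values `0` on `E` and
at most `ψ k` on `J k` is at most the corresponding combination of harmonic measures. -/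
lemma limit_le_sum_harmonicMeasure (hK : IsCompact (E ∪ ⋃ k, J k))
    (hg : IsGreenFunction (E ∪ ⋃ k, J k) OnePoint.infty g) (hE : ∀ k, Disjoint E (J k))
    (hJ : ∀ k k', k ≠ k' → Disjoint (J k) (J k'))
    (hw : ∀ k, IsHarmonicMeasure (J k) (E ∪ ⋃ k, J k) (w k))
    (hd : ∀ q ∈ sphereCompl (E ∪ ⋃ k, J k), q ≠ OnePoint.infty → HarmonicAtSphere d q)
    (hdE : ∀ x ∈ E, Tendsto (fun z : ℂ => d z) (𝓝[(E ∪ ⋃ k, J k)ᶜ] x) (𝓝 0)) {ψ : ι → ℝ}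
    (hdJ : ∀ k, ∀ x ∈ J k, ∃ y ≤ ψ k,
      Tendsto (fun z : ℂ => d z) (𝓝[(E ∪ ⋃ k, J k)ᶜ] x) (𝓝 y))
    (hD : Tendsto d (𝓝[≠] OnePoint.infty) (𝓝 D)) :
    D ≤ ∑ k, ψ k * w k OnePoint.infty := by
  classical
  set K := E ∪ ⋃ k, J k with hKdef
  have hinf := infty_mem_sphereCompl K
  have hs : ∀ q ∈ sphereCompl K, HarmonicAtSphere (fun q => ∑ k, ψ k * w k q) q := fun q hq =>
    HarmonicAtSphere.sum fun k _ => ((hw k).harmonic q hq).const_mul _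
  have hst : Tendsto (fun q => ∑ k, ψ k * w k q) (𝓝[≠] OnePoint.infty)
      (𝓝 (∑ k, ψ k * w k OnePoint.infty)) :=
    (hs _ hinf).continuousAt.tendsto.mono_left nhdsWithin_le_nhds
  have key := hg.nonneg_of_boundary hK hinf (u := fun q => ∑ k, ψ k * w k q - d q)
    (fun q hq hqi => (hs q hq).sub (hd q hq hqi)) ?_ (eventually_const_le_of_tendsto (hst.sub hD))
  · have hev : ∀ᶠ q in 𝓝[≠] (OnePoint.infty : OnePoint ℂ), 0 ≤ ∑ k, ψ k * w k q - d q := by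
      filter_upwards [self_mem_nhdsWithin,
        nhdsWithin_le_nhds ((isOpen_sphereCompl hK).mem_nhds hinf)] with q hq hq'
      exact key q hq' hq
    linarith [ge_of_tendsto (hst.sub hD) hev]
  · rintro x (hx | hx)
    · have h1 : Tendsto (fun z : ℂ => ∑ k, ψ k * w k z) (𝓝[Kᶜ] x) (𝓝 (∑ k, ψ k * 0)) :=
        tendsto_finsetSum _ fun k _ => ((hw k).boundary_zero x
          ⟨Or.inl hx, disjoint_left.1 (hE k) hx⟩).const_mul _
      exact eventually_neg_lt_of_tendsto (h1.sub (hdE x hx)) (by simp)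
    · obtain ⟨k₀, hk₀⟩ := mem_iUnion.1 hx
      obtain ⟨y, hy, hyt⟩ := hdJ k₀ x hk₀
      have h1 : Tendsto (fun z : ℂ => ∑ k, ψ k * w k z) (𝓝[Kᶜ] x)
          (𝓝 (∑ k, ψ k * if k = k₀ then 1 else 0)) := by
        refine tendsto_finsetSum _ fun k _ => Tendsto.const_mul _ ?_
        by_cases hk : k = k₀
        · subst hk
          simpa using (hw k).boundary_one x hk₀
        · simpa [hk] using (hw k).boundary_zero x
            ⟨Or.inr hx, fun hxk => disjoint_left.1 (hJ k k₀ hk) hxk hk₀⟩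
      exact eventually_neg_lt_of_tendsto (h1.sub hyt) (by simpa using hy)

lemma abs_limit_sub_sum_le (hK : IsCompact (E ∪ ⋃ k, J k))
    (hg : IsGreenFunction (E ∪ ⋃ k, J k) OnePoint.infty g) (hE : ∀ k, Disjoint E (J k))
    (hJ : ∀ k k', k ≠ k' → Disjoint (J k) (J k'))
    (hw : ∀ k, IsHarmonicMeasure (J k) (E ∪ ⋃ k, J k) (w k))
    (hd : ∀ q ∈ sphereCompl (E ∪ ⋃ k, J k), q ≠ OnePoint.infty → HarmonicAtSphere d q)
    (hdE : ∀ x ∈ E, Tendsto (fun z : ℂ => d z) (𝓝[(E ∪ ⋃ k, J k)ᶜ] x) (𝓝 0)) {φ : ι → ℝ} {e : ℝ}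
    (hdJ : ∀ k, ∀ x ∈ J k, ∃ y, |y - φ k| ≤ e ∧
      Tendsto (fun z : ℂ => d z) (𝓝[(E ∪ ⋃ k, J k)ᶜ] x) (𝓝 y))
    (hD : Tendsto d (𝓝[≠] OnePoint.infty) (𝓝 D)) :
    |D - ∑ k, w k OnePoint.infty * φ k| ≤ e * ∑ k, w k OnePoint.infty := by
  have h1 := limit_le_sum_harmonicMeasure hK hg hE hJ hw hd hdE (ψ := fun k => φ k + e)
    (fun k x hx => by
      obtain ⟨y, hy, hyt⟩ := hdJ k x hx
      exact ⟨y, by linarith [(abs_le.1 hy).2], hyt⟩) hD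
  have h2 := limit_le_sum_harmonicMeasure hK hg hE hJ hw (fun q hq hqi => (hd q hq hqi).neg)
    (fun x hx => by simpa using (hdE x hx).neg) (ψ := fun k => -φ k + e)
    (fun k x hx => by
      obtain ⟨y, hy, hyt⟩ := hdJ k x hx
      exact ⟨-y, by linarith [(abs_le.1 hy).1], hyt.neg⟩) hD.neg
  have e1 : ∑ k, (φ k + e) * w k OnePoint.infty =
      ∑ k, w k OnePoint.infty * φ k + e * ∑ k, w k OnePoint.infty := by
    rw [Finset.mul_sum, ← Finset.sum_add_distrib]
    exact Finset.sum_congr rfl fun k _ => by ring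
  have e2 : ∑ k, (-φ k + e) * w k OnePoint.infty =
      -∑ k, w k OnePoint.infty * φ k + e * ∑ k, w k OnePoint.infty := by
    rw [Finset.mul_sum, ← Finset.sum_neg_distrib, ← Finset.sum_add_distrib]
    exact Finset.sum_congr rfl fun k _ => by ring
  rw [e1] at h1
  rw [e2] at h2
  rw [abs_le]
  constructor <;> linarith

end Comparison

/-! ### Asymptotics for shrinking intervals -/

section Asymptotics

variable {ι : Type*} [Fintype ι]

lemma sq_iSup_le [Nonempty ι] (ω : ι → ℝ) : (⨆ k, ω k) ^ 2 ≤ ⨆ k, ω k ^ 2 := by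
  obtain ⟨k, hk⟩ := exists_eq_ciSup_of_finite (f := ω)
  rw [← hk]
  exact le_ciSup (f := fun k => ω k ^ 2) (finite_range _).bddAbove k

lemma interval_subset_interval {b c b' c' : ℝ} (h1 : b' ≤ b) (h2 : c ≤ c') :
    interval b c ⊆ interval b' c' :=
  image_mono (Icc_subset_Icc h1 h2)

/-- The lengths of the small intervals are bounded by a multiple of the largest harmonic measure, once
the harmonic measures are small. The set lies in `[-R, R]` with `R` a constant plus the largest
length, so a large length would force a harmonic measure bounded below. -/
lemma exists_length_le [Nonempty ι] {E : Set ℂ} (hE : IsCompact E) {r : ℝ}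
    (hEr : E ⊆ interval (-r) r) {B C : ι → ℕ → ℝ} {c : ι → ℝ} (hBC : ∀ k n, B k n < C k n)
    (hc : ∀ k n, c k ∈ Icc (B k n) (C k n)) {w : ι → ℕ → OnePoint ℂ → ℝ}
    (hw : ∀ k n, IsHarmonicMeasure (interval (B k n) (C k n))
      (E ∪ ⋃ k, interval (B k n) (C k n)) (w k n))
    (hw0 : ∀ k, Tendsto (fun n => w k n OnePoint.infty) atTop (𝓝 0)) :
    ∃ A, 0 ≤ A ∧ ∀ᶠ n in atTop, ∀ k, C k n - B k n ≤ A * ⨆ k, w k n OnePoint.infty := by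
  obtain ⟨r₀, hr₀0, hr₀, hcr⟩ : ∃ r₀, 0 < r₀ ∧ r ≤ r₀ ∧ ∀ k, |c k| ≤ r₀ := by
    refine ⟨|r| + 1 + ∑ k, |c k|, by positivity, ?_, fun k => ?_⟩
    · have : 0 ≤ ∑ k, |c k| := by positivity
      linarith [le_abs_self r]
    · have := Finset.single_le_sum (f := fun k => |c k|) (fun _ _ => abs_nonneg _) (Finset.mem_univ k)
      have h := abs_nonneg r
      linarith
  have hpi := Real.pi_pos
  set η : ℝ := 1 / (16 * Real.pi) with hη
  have hη0 : 0 < η := by positivity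
  refine ⟨2 * r₀ / η, by positivity, ?_⟩
  have hsmall : ∀ᶠ n in atTop, ∀ k, w k n OnePoint.infty < η / 2 :=
    eventually_all.2 fun k => (hw0 k).eventually (gt_mem_nhds (by positivity))
  filter_upwards [hsmall] with n hn
  obtain ⟨k₀, hk₀⟩ := exists_eq_ciSup_of_finite (f := fun k => C k n - B k n)
  have hle : ∀ k, C k n - B k n ≤ C k₀ n - B k₀ n := fun k => by
    have := le_ciSup (f := fun k => C k n - B k n) (finite_range _).bddAbove k
    rw [← hk₀] at this
    exact this
  set M := C k₀ n - B k₀ n with hM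
  have hM0 : 0 < M := sub_pos.2 (hBC k₀ n)
  have hKc : IsCompact (E ∪ ⋃ k, interval (B k n) (C k n)) :=
    hE.union (isCompact_iUnion fun k => isCompact_interval _ _)
  have hsub : (E ∪ ⋃ k, interval (B k n) (C k n)) ⊆ interval (-(r₀ + M)) (r₀ + M) := by
    refine union_subset (hEr.trans (interval_subset_interval (by linarith) (by linarith)))
      (iUnion_subset fun k => interval_subset_interval ?_ ?_)
    · have h1 := (hc k n).2
      have h2 := (abs_le.1 (hcr k)).1
      linarith [hle k]
    · have h1 := (hc k n).1
      have h2 := (abs_le.1 (hcr k)).2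
      linarith [hle k]
  have hlow := le_harmonicMeasure_interval hKc (hBC k₀ n)
    ((subset_iUnion (fun k => interval (B k n) (C k n)) k₀).trans subset_union_right) hsub (hw k₀ n)
  have e : (C k₀ n - B k₀ n) / (16 * Real.pi * (r₀ + M)) = η * M / (r₀ + M) := by
    rw [hη, ← hM]; field_simp
  rw [e, div_le_iff₀ (by positivity)] at hlow
  have hMr : M ≤ r₀ := by
    have := hn k₀
    nlinarith
  have hsup : w k₀ n OnePoint.infty ≤ ⨆ k, w k n OnePoint.infty :=
    le_ciSup (f := fun k => w k n OnePoint.infty) (finite_range _).bddAbove k₀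
  intro k
  refine (hle k).trans ?_
  rw [div_mul_eq_mul_div, le_div_iff₀ hη0]
  have : 0 ≤ w k₀ n OnePoint.infty := by nlinarith
  nlinarith

/-- The common asymptotic formula. If `d n` vanishes on `E` and agrees with a fixed function `φ`,
differentiable at the points `c k`, on the small intervals, then its value `D n` at `∞` is
`∑ k, ω k * φ (c k)` up to an error of second order in the harmonic measures `ω k`: on each small
interval `φ` differs from `φ (c k)` by at most a multiple of the length, which is of first order. -/
theorem isBigO_limit_sub_sum [Nonempty ι] {E : Set ℂ} (hE : IsCompact E) {r : ℝ}
    (hEr : E ⊆ interval (-r) r) {B C : ι → ℕ → ℝ} {c : ι → ℝ} (hBC : ∀ k n, B k n < C k n)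
    (hc : ∀ k n, c k ∈ Icc (B k n) (C k n)) {w : ι → ℕ → OnePoint ℂ → ℝ}
    (hEJ : ∀ n k, Disjoint E (interval (B k n) (C k n)))
    (hJ : ∀ n k k', k ≠ k' → Disjoint (interval (B k n) (C k n)) (interval (B k' n) (C k' n)))
    (hw : ∀ k n, IsHarmonicMeasure (interval (B k n) (C k n))
      (E ∪ ⋃ k, interval (B k n) (C k n)) (w k n))
    (hw0 : ∀ k, Tendsto (fun n => w k n OnePoint.infty) atTop (𝓝 0))
    {g d : ℕ → OnePoint ℂ → ℝ} {φ : ℂ → ℝ} {D : ℕ → ℝ}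
    (hg : ∀ n, IsGreenFunction (E ∪ ⋃ k, interval (B k n) (C k n)) OnePoint.infty (g n))
    (hd : ∀ n, ∀ q ∈ sphereCompl (E ∪ ⋃ k, interval (B k n) (C k n)), q ≠ OnePoint.infty →
      HarmonicAtSphere (d n) q)
    (hdE : ∀ n, ∀ x ∈ E, Tendsto (fun z : ℂ => d n z)
      (𝓝[(E ∪ ⋃ k, interval (B k n) (C k n))ᶜ] x) (𝓝 0))
    (hdJ : ∀ n k, ∀ x ∈ interval (B k n) (C k n), Tendsto (fun z : ℂ => d n z)
      (𝓝[(E ∪ ⋃ k, interval (B k n) (C k n))ᶜ] x) (𝓝 (φ x)))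
    (hφ : ∀ k, DifferentiableAt ℝ φ (c k))
    (hD : ∀ n, Tendsto (d n) (𝓝[≠] OnePoint.infty) (𝓝 (D n))) :
    (fun n => D n - ∑ k, w k n OnePoint.infty * φ (c k)) =O[atTop]
      fun n => ⨆ k, w k n OnePoint.infty ^ 2 := by
  have hKc : ∀ n, IsCompact (E ∪ ⋃ k, interval (B k n) (C k n)) := fun n =>
    hE.union (isCompact_iUnion fun k => isCompact_interval _ _)
  have hwnn : ∀ k n, 0 ≤ w k n OnePoint.infty := fun k n => by
    refine nonneg_of_boundary (hKc n) ⟨c k, Or.inr (mem_iUnion.2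
      ⟨k, ofReal_mem_interval.2 (hc k n)⟩)⟩ (hw k n).harmonic (fun x hx => ?_) _
      (infty_mem_sphereCompl _)
    by_cases hxJ : x ∈ interval (B k n) (C k n)
    · exact eventually_neg_lt_of_tendsto ((hw k n).boundary_one x hxJ) zero_le_one
    · exact eventually_neg_lt_of_tendsto ((hw k n).boundary_zero x ⟨hx, hxJ⟩) le_rfl
  obtain ⟨A, hA0, hA⟩ := exists_length_le hE hEr hBC hc hw hw0
  have hL : ∀ k, ∃ L, 0 ≤ L ∧ ∃ s > 0, ∀ x : ℂ, ‖x - c k‖ < s → |φ x - φ (c k)| ≤ L * ‖x - c k‖ := by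
    intro k
    obtain ⟨L, hL0, hL⟩ := (hφ k).isBigO_sub.exists_nonneg
    obtain ⟨s, hs, hball⟩ := Metric.eventually_nhds_iff.1 hL.bound
    exact ⟨L, hL0, s, hs, fun x hx => hball (by rwa [dist_eq_norm])⟩
  choose L hL0 s hs hLs using hL
  have hLle : ∀ k, L k ≤ ∑ k, L k := fun k =>
    Finset.single_le_sum (fun k _ => hL0 k) (Finset.mem_univ k)
  have hS0 : 0 ≤ ∑ k, L k := Finset.sum_nonneg fun k _ => hL0 k
  have hlen : ∀ᶠ n in atTop, ∀ k, A * ⨆ k, w k n OnePoint.infty < s k := by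
    refine eventually_all.2 fun k => ?_
    have h1 : ∀ᶠ n in atTop, ∀ i, w i n OnePoint.infty < s k / (A + 1) :=
      eventually_all.2 fun i => (hw0 i).eventually (gt_mem_nhds (div_pos (hs k) (by linarith)))
    filter_upwards [h1] with n hn
    obtain ⟨i, hi⟩ := exists_eq_ciSup_of_finite (f := fun k => w k n OnePoint.infty)
    rw [← hi]
    have := hn i
    rw [lt_div_iff₀ (by linarith)] at this
    nlinarith [hwnn i n]
  -- `φ` varies by at most `(∑ k, L k) * A * W`, and the harmonic measures add up to at most
  -- `card ι * W`
  refine IsBigO.of_bound ((∑ k, L k) * A * Fintype.card ι) ?_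
  filter_upwards [hA, hlen] with n hn hn'
  set W := ⨆ k, w k n OnePoint.infty with hW
  have hwW : ∀ k, w k n OnePoint.infty ≤ W := fun k =>
    le_ciSup (f := fun k => w k n OnePoint.infty) (finite_range _).bddAbove k
  have hW0 : 0 ≤ W := (hwnn (Classical.arbitrary ι) n).trans (hwW _)
  have hmain := abs_limit_sub_sum_le (hKc n) (hg n) (hEJ n) (hJ n) (fun k => hw k n) (hd n) (hdE n)
    (φ := fun k => φ (c k)) (e := (∑ k, L k) * (A * W)) (fun k x hx => ?_) (hD n)
  · have hsum : ∑ k, w k n OnePoint.infty ≤ Fintype.card ι * W := by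
      have := Finset.sum_le_card_nsmul Finset.univ (fun k => w k n OnePoint.infty) W
        fun k _ => hwW k
      simpa using this
    have hsq : W ^ 2 ≤ ⨆ k, w k n OnePoint.infty ^ 2 := sq_iSup_le _
    have hsup0 : 0 ≤ ⨆ k, w k n OnePoint.infty ^ 2 := (sq_nonneg W).trans hsq
    rw [Real.norm_eq_abs, Real.norm_of_nonneg hsup0]
    calc _ ≤ _ := hmain
      _ ≤ (∑ k, L k) * (A * W) * (Fintype.card ι * W) := by gcongr
      _ = (∑ k, L k) * A * Fintype.card ι * W ^ 2 := by ring
      _ ≤ _ := by gcongr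
  · refine ⟨φ x, ?_, hdJ n k x hx⟩
    have hdist : ‖x - c k‖ ≤ A * W := by
      obtain ⟨t, ht, rfl⟩ := hx
      refine le_trans ?_ (hn k)
      rw [← Complex.ofReal_sub, Complex.norm_real, Real.norm_eq_abs, abs_le]
      constructor <;> linarith [ht.1, ht.2, (hc k n).1, (hc k n).2]
    calc |φ x - φ (c k)| ≤ L k * ‖x - c k‖ := hLs k x (hdist.trans_lt (hn' k))
      _ ≤ (∑ k, L k) * (A * W) := by
        gcongr
        exact hLle k

end Asymptotics

/-! ### The bands -/

section Bands

variable {l : ℕ} {a : Fin (2 * l) → ℝ}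

lemma disjoint_interval {b c b' c' : ℝ} (h : Disjoint (Icc b c) (Icc b' c')) :
    Disjoint (interval b c) (interval b' c') :=
  (disjoint_image_iff Complex.ofReal_injective).2 h

lemma disjoint_band (ha : StrictMono a) {i j : Fin l} (hij : i ≠ j) :
    Disjoint (band a i) (band a j) := by
  wlog h : i < j generalizing i j
  · exact (this hij.symm (lt_of_le_of_ne (not_lt.1 h) hij.symm)).symm
  refine disjoint_interval (disjoint_left.2 fun x hx hx' => ?_)
  have h1 : a ⟨2 * i.1 + 1, by omega⟩ < a ⟨2 * j.1, by omega⟩ := by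
    refine ha (Fin.mk_lt_mk.2 ?_)
    have : i.1 < j.1 := h
    omega
  linarith [hx.2, hx'.1]

lemma band_lt (ha : StrictMono a) (j : Fin l) :
    a ⟨2 * j.1, by omega⟩ < a ⟨2 * j.1 + 1, by omega⟩ :=
  ha (Fin.mk_lt_mk.2 (by omega))

lemma exists_bands_subset_interval (a : Fin (2 * l) → ℝ) : ∃ r, bands a ⊆ interval (-r) r := by
  refine ⟨∑ i, |a i|, iUnion_subset fun j => interval_subset_interval ?_ ?_⟩
  · have := Finset.single_le_sum (f := fun i => |a i|) (fun _ _ => abs_nonneg _)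
      (Finset.mem_univ (⟨2 * j.1, by omega⟩ : Fin (2 * l)))
    linarith [neg_abs_le (a ⟨2 * j.1, by omega⟩)]
  · have := Finset.single_le_sum (f := fun i => |a i|) (fun _ _ => abs_nonneg _)
      (Finset.mem_univ (⟨2 * j.1 + 1, by omega⟩ : Fin (2 * l)))
    linarith [le_abs_self (a ⟨2 * j.1 + 1, by omega⟩)]

end Bands

end GreenInterval

theorem mainTheorem2 (l m : ℕ) (hl : 1 ≤ l) (hm : 1 ≤ m)
    (a : Fin (2 * l) → ℝ) (ha : StrictMono a)
    (B C : Fin m → ℕ → ℝ) (c : Fin m → ℝ)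
    (hBC : ∀ k n, B k n < C k n)
    (hdisj : ∀ n, ∀ k k' : Fin m, k ≠ k' →
      Disjoint (Set.Icc (B k n) (C k n)) (Set.Icc (B k' n) (C k' n)))
    (hdist : ∃ δ : ℝ, 0 < δ ∧ ∀ n, ∀ x ∈ GreenInterval.bands a,
      ∀ y ∈ GreenInterval.smallIntervals B C n, δ ≤ dist x y)
    (hc : ∀ k, ⋂ n, Set.Icc (B k n) (C k n) = {c k})
    (ω : Fin m → ℕ → ℝ)
    (hω : ∀ k n, ω k n = GreenInterval.harmonicMeasure OnePoint.infty
      (GreenInterval.interval (B k n) (C k n))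
      (GreenInterval.bands a ∪ GreenInterval.smallIntervals B C n))
    (hω0 : ∀ k, Filter.Tendsto (ω k) Filter.atTop (nhds 0)) :
    (∃ ε : ℕ → ℝ, (ε =O[Filter.atTop] fun n => ⨆ k, ω k n ^ 2) ∧
      ∀ n, GreenInterval.capacity (GreenInterval.bands a ∪ GreenInterval.smallIntervals B C n) =
        GreenInterval.capacity (GreenInterval.bands a) *
          (∏ k, GreenInterval.absPhi OnePoint.infty ((c k : ℂ) : OnePoint ℂ)
            (GreenInterval.bands a) ^ ω k n) * (1 + ε n)) ∧
    (∀ j : Fin l, ∃ ε : ℕ → ℝ, (ε =O[Filter.atTop] fun n => ⨆ k, ω k n ^ 2) ∧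
      ∀ n, GreenInterval.harmonicMeasure OnePoint.infty (GreenInterval.band a j)
          (GreenInterval.bands a ∪ GreenInterval.smallIntervals B C n) =
        GreenInterval.harmonicMeasure OnePoint.infty (GreenInterval.band a j)
            (GreenInterval.bands a) -
          (∑ k, ω k n * GreenInterval.harmonicMeasure ((c k : ℂ) : OnePoint ℂ)
            (GreenInterval.band a j) (GreenInterval.bands a)) + ε n) := by
  open GreenInterval in
  have : Nonempty (Fin m) := ⟨⟨0, hm⟩⟩
  have : Nonempty (Fin l) := ⟨⟨0, hl⟩⟩
  obtain ⟨δ, hδ, hdist⟩ := hdist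
  have hcm : ∀ k n, c k ∈ Icc (B k n) (C k n) := fun k n => by
    have : c k ∈ ⋂ n, Icc (B k n) (C k n) := by rw [hc]; rfl
    exact mem_iInter.1 this n
  have hE : ∀ i j : Fin l, i ≠ j → Disjoint (band a i) (band a j) := fun i j h => disjoint_band ha h
  have hJ : ∀ n k k', k ≠ k' → Disjoint (interval (B k n) (C k n)) (interval (B k' n) (C k' n)) :=
    fun n k k' h => disjoint_interval (hdisj n k k' h)
  have hEI : ∀ n k, Disjoint (bands a) (interval (B k n) (C k n)) := by
    refine fun n k => disjoint_left.2 fun x hx hx' => ?_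
    have := hdist n x hx x (mem_iUnion.2 ⟨k, hx'⟩)
    rw [dist_self] at this
    linarith
  -- `E` and `E ∪ I_n` as unions of indexed families of disjoint intervals
  have hEreg : IsRegularCompact (bands a) := isRegularCompact_iUnion_interval (band_lt ha) hE
  have hEm : ∀ j, IsHarmonicMeasure (band a j) (bands a)
      fun q => harmonicMeasure q (band a j) (bands a) := isHarmonicMeasure_interval (band_lt ha) hE
  let b' : ℕ → Fin l ⊕ Fin m → ℝ := fun n => Sum.elim (fun j => a ⟨2 * j.1, by omega⟩) fun k => B k n
  let c' : ℕ → Fin l ⊕ Fin m → ℝ := fun n =>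
    Sum.elim (fun j => a ⟨2 * j.1 + 1, by omega⟩) fun k => C k n
  have hlt : ∀ n i, b' n i < c' n i := fun n => by
    rintro (j | k)
    · exact band_lt ha j
    · exact hBC k n
  have hEJ : ∀ n j k, Disjoint (band a j) (interval (B k n) (C k n)) := fun n j k =>
    (hEI n k).mono_left (subset_iUnion (band a) j)
  have hdis : ∀ n i i', i ≠ i' → Disjoint (interval (b' n i) (c' n i)) (interval (b' n i') (c' n i')) := by
    intro n
    rintro (j | k) (j' | k') h
    · exact hE j j' fun h' => h (by rw [h'])
    · exact hEJ n j k'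
    · exact (hEJ n j' k).symm
    · exact hJ n k k' fun h' => h (by rw [h'])
  have hun : ∀ n, ⋃ i, interval (b' n i) (c' n i) = bands a ∪ smallIntervals B C n := fun n => by
    rw [iUnion_sum]; rfl
  have hKreg : ∀ n, IsRegularCompact (bands a ∪ smallIntervals B C n) := fun n => by
    rw [← hun n]; exact isRegularCompact_iUnion_interval (hlt n) (hdis n)
  have hKm := fun n => isHarmonicMeasure_interval (hlt n) (hdis n)
  simp only [hun] at hKm
  have hw : ∀ k n, IsHarmonicMeasure (interval (B k n) (C k n)) (bands a ∪ smallIntervals B C n)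
      fun q => harmonicMeasure q (interval (B k n) (C k n)) (bands a ∪ smallIntervals B C n) :=
    fun k n => hKm n (Sum.inr k)
  have hwE : ∀ j n, IsHarmonicMeasure (band a j) (bands a ∪ smallIntervals B C n)
      fun q => harmonicMeasure q (band a j) (bands a ∪ smallIntervals B C n) :=
    fun j n => hKm n (Sum.inl j)
  have hgreen : ∀ {K : Set ℂ}, IsRegularCompact K →
      IsGreenFunction K OnePoint.infty (greenFunction K OnePoint.infty) := fun hK =>
    isGreenFunction_greenFunction (let ⟨g, _, hg⟩ := hK.green; ⟨g, hg.isGreenFunction⟩)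
  obtain ⟨r, hr⟩ := exists_bands_subset_interval a
  have hcE : ∀ k, (c k : ℂ) ∉ bands a := fun k =>
    disjoint_right.1 (hEI 0 k) (ofReal_mem_interval.2 (hcm k 0))
  have hw0 : ∀ k, Tendsto (fun n => harmonicMeasure OnePoint.infty (interval (B k n) (C k n))
      (bands a ∪ smallIntervals B C n)) atTop (𝓝 0) := fun k =>
    (hω0 k).congr fun n => hω k n
  have hsubE : ∀ n, bands a ⊆ bands a ∪ smallIntervals B C n := fun n => subset_union_left
  have hmono : ∀ n x, 𝓝[(bands a ∪ smallIntervals B C n)ᶜ] x ≤ 𝓝[(bands a)ᶜ] x := fun n x =>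
    nhdsWithin_mono _ (compl_subset_compl.2 (hsubE n))
  have hJE : ∀ n k, ∀ x ∈ interval (B k n) (C k n), x ∉ bands a := fun n k x hx =>
    disjoint_right.1 (hEI n k) hx
  have hJK : ∀ n k, interval (B k n) (C k n) ⊆ bands a ∪ smallIntervals B C n := fun n k =>
    (subset_iUnion (fun k => interval (B k n) (C k n)) k).trans subset_union_right
  have hfun : (fun n => ⨆ k, ω k n ^ 2) = fun n => ⨆ k, harmonicMeasure OnePoint.infty
      (interval (B k n) (C k n)) (bands a ∪ smallIntervals B C n) ^ 2 := by
    funext n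
    simp only [hω]
  constructor
  · -- the difference of the Green's functions of `E` and `E ∪ I_n` at `∞`
    have hv := hgreen hEreg
    have hu := fun n => hgreen (hKreg n)
    obtain ⟨γ, hγ⟩ := hv.pole
    choose γ' hγ' using fun n => (hu n).pole
    have hO := isBigO_limit_sub_sum hEreg.isCompact hr hBC hcm hEI hJ hw hw0
      (d := fun n q => greenFunction (bands a) OnePoint.infty q -
        greenFunction (bands a ∪ smallIntervals B C n) OnePoint.infty q)
      (φ := fun z => greenFunction (bands a) OnePoint.infty z) (D := fun n => γ - γ' n) hu
      (fun n q hq hqi => (hv.harmonic q (sphereCompl_anti (hsubE n) hq) hqi).sub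
        ((hu n).harmonic q hq hqi))
      (fun n x hx => by
        have h1 := ((hv.boundary x hx).mono_left (hmono n x)).sub ((hu n).boundary x (hsubE n hx))
        rwa [sub_zero] at h1)
      (fun n k x hx => by
        have h1 := (hv.harmonic x (coe_mem_sphereCompl.2 (hJE n k x hx))
          (OnePoint.coe_ne_infty x)).1.continuousAt.tendsto.mono_left
          (nhdsWithin_le_nhds (s := (bands a ∪ smallIntervals B C n)ᶜ))
        have h2 := h1.sub ((hu n).boundary x (hJK n k hx))
        rwa [sub_zero] at h2)
      (fun k => (hv.harmonic _ (coe_mem_sphereCompl.2 (hcE k))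
        (OnePoint.coe_ne_infty _)).1.differentiableAt two_ne_zero)
      (fun n => by
        rw [nhdsNE_infty, tendsto_map'_iff]
        exact (hγ.sub (hγ' n)).congr fun z => by simp)
    have hsymm : ∀ k, greenFunction (bands a) (c k : ℂ) OnePoint.infty =
        greenFunction (bands a) OnePoint.infty (c k : ℂ) := by
      intro k
      have hcov : ∀ x ∈ bands a, ∃ b c : ℝ, b < c ∧ x ∈ interval b c ∧ interval b c ⊆ bands a := by
        intro x hx
        obtain ⟨j, hj⟩ := mem_iUnion.1 hx
        exact ⟨_, _, band_lt ha j, hj, subset_iUnion (band a) j⟩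
      obtain ⟨g, ρ, hg⟩ := hEreg.green
      obtain ⟨G, hG, hGi⟩ := exists_isGreenFunction_infty_eq hEreg hcov hg (hcE k)
      have hcS := coe_mem_sphereCompl.2 (hcE k)
      rw [(isGreenFunction_greenFunction ⟨G, hG⟩).unique hG hEreg.isCompact hcS _
        (infty_mem_sphereCompl _) (OnePoint.infty_ne_coe _), hGi]
      exact hg.isGreenFunction.unique hv hEreg.isCompact (infty_mem_sphereCompl _) _ hcS
        (OnePoint.coe_ne_infty _)
    set s : ℕ → ℝ := fun n => γ - γ' n - ∑ k, ω k n *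
      greenFunction (bands a) OnePoint.infty (c k : ℂ) with hs
    have hsO : s =O[atTop] fun n => ⨆ k, ω k n ^ 2 := by
      rw [hfun]
      refine hO.congr_left fun n => ?_
      simp only [hs, hω]
    have hs0 : Tendsto s atTop (𝓝 0) := by
      have hle : ∀ n, |⨆ k, ω k n ^ 2| ≤ ∑ k, ω k n ^ 2 := fun n => by
        obtain ⟨k, hk⟩ := exists_eq_ciSup_of_finite (f := fun k => ω k n ^ 2)
        rw [← hk, abs_of_nonneg (sq_nonneg _)]
        exact Finset.single_le_sum (f := fun k => ω k n ^ 2) (fun k _ => sq_nonneg _)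
          (Finset.mem_univ k)
      have hz : Tendsto (fun n => ∑ k, ω k n ^ 2) atTop (𝓝 0) := by
        simpa using tendsto_finsetSum Finset.univ fun k _ => (hω0 k).pow 2
      exact hsO.trans_tendsto (squeeze_zero_norm hle hz)
    refine ⟨fun n => Real.exp (s n) - 1, ?_, fun n => ?_⟩
    · refine IsBigO.trans (IsBigO.of_bound 2 ?_) hsO
      filter_upwards [hs0.norm.eventually (gt_mem_nhds (by simp : ‖(0 : ℝ)‖ < 1))] with n hn
      exact Real.abs_exp_sub_one_le hn.le
    · have hprod : ∏ k, absPhi OnePoint.infty (c k : ℂ) (bands a) ^ ω k n =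
          Real.exp (∑ k, ω k n * greenFunction (bands a) OnePoint.infty (c k : ℂ)) := by
        rw [Real.exp_sum]
        refine Finset.prod_congr rfl fun k _ => ?_
        rw [absPhi, hsymm, ← Real.exp_mul, mul_comm]
      rw [capacity_eq hγ, capacity_eq (hγ' n), hprod, add_sub_cancel, ← Real.exp_add,
        ← Real.exp_add]
      congr 1
      simp only [hs]
      ring
  · intro j
    have hh := hEm j
    have hO := isBigO_limit_sub_sum hEreg.isCompact hr hBC hcm hEI hJ hw hw0
      (d := fun n q => harmonicMeasure q (band a j) (bands a) -
        harmonicMeasure q (band a j) (bands a ∪ smallIntervals B C n))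
      (φ := fun z => harmonicMeasure z (band a j) (bands a))
      (D := fun n => harmonicMeasure OnePoint.infty (band a j) (bands a) -
        harmonicMeasure OnePoint.infty (band a j) (bands a ∪ smallIntervals B C n))
      (fun n => hgreen (hKreg n))
      (fun n q hq _ => (hh.harmonic q (sphereCompl_anti (hsubE n) hq)).sub
        ((hwE j n).harmonic q hq))
      (fun n x hx => by
        by_cases hxj : x ∈ band a j
        · have h1 := ((hh.boundary_one x hxj).mono_left (hmono n x)).sub
            ((hwE j n).boundary_one x hxj)
          rwa [sub_self] at h1
        · have h1 := ((hh.boundary_zero x ⟨hx, hxj⟩).mono_left (hmono n x)).sub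
            ((hwE j n).boundary_zero x ⟨hsubE n hx, hxj⟩)
          rwa [sub_zero] at h1)
      (fun n k x hx => by
        have h1 := (hh.harmonic x (coe_mem_sphereCompl.2
          (hJE n k x hx))).1.continuousAt.tendsto.mono_left
          (nhdsWithin_le_nhds (s := (bands a ∪ smallIntervals B C n)ᶜ))
        have h2 := h1.sub ((hwE j n).boundary_zero x
          ⟨hJK n k hx, disjoint_right.1 (hEJ n j k) hx⟩)
        rwa [sub_zero] at h2)
      (fun k => (hh.harmonic _ (coe_mem_sphereCompl.2 (hcE k))).1.differentiableAt two_ne_zero)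
      (fun n => ((hh.harmonic _ (infty_mem_sphereCompl _)).sub
        ((hwE j n).harmonic _ (infty_mem_sphereCompl _))).continuousAt.tendsto.mono_left
          nhdsWithin_le_nhds)
    refine ⟨_, hfun ▸ hO.neg_left, fun n => ?_⟩
    simp only [hω]
    ring
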